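/- Let $\mathfrak{Hilb}$ be the monoidal $W^*$-category of Hilbert spaces with the Hilbert space tensor product. A \emph{Hilbert space tensor category} is a monoidal $W^*$-category $\mathcal C$ with a faithful strict monoidal functor $\mathfrak{For}\colon\mathcal C\to\mathfrak{Hilb}$, so that $\mathcal C(x_1,x_2)\subseteq\mathbb B(\mathfrak{For}(x_1),\mathfrak{For}(x_2))$ is a weakly closed subspace, and a strict monoidal functor $\tau\colon\mathfrak{Hilb}\to\mathcal C$ with $\mathfrak{For}\circ\tau=\mathrm{id}$, such that: (a) if $\mathfrak{For}(x)=\mathfrak{For}(x')$ and the identity operator belongs to $\mathcal C(x,x')$, then $x=x'$; (b) if $a\colon\mathfrak{For}(x_1)\to\mathfrak{For}(x_2)$ is a bounded operator and $a\otimes\mathrm{id}$ belongs to $\mathcal C(x_1\otimes y,x_2\otimes y)$ or $\mathrm{id}\otimes a$ belongs to $\mathcal C(y\otimes x_1,y\otimes x_2)$ for some $y$ with $\mathfrak{For}(y)\neq0$, then $a\in\mathcal C(x_1,x_2)$. Write $\mathcal H^x:=\mathfrak{For}(x)$ and $\tau(x):=\tau(\mathfrak{For}(x))$. A \emph{natural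 right absorber} in $\mathcal C$ is an object $\rho$ with unitary arrows $U^x\in\mathcal C(x\otimes\rho,\tau(x)\otimes\rho)$ for all objects $x$ of $\mathcal C$ such that $U^{x_2}(a\otimes\mathrm{id}_\rho)=(a\otimes\mathrm{id}_\rho)U^{x_1}$ for all $a\in\mathcal C(x_1,x_2)$ and $U^{x_1\otimes x_2}=U^{x_1}_{13}U^{x_2}_{23}$ for all $x_1,x_2$, in leg numbering notation. Let $(\rho,(U^x)_x)$ and $(\check\rho,(\check U^x)_x)$ be two natural right absorbers in the same Hilbert space tensor category $\mathcal C$. Let $\mathcal H:=\mathcal H^\rho$, $\check{\mathcal H}:=\mathcal H^{\check\rho}$, $U:=U^\rho\in\mathcal U(\mathcal H\otimes\mathcal H)$, $\check U:=\check U^{\check\rho}\in\mathcal U(\check{\mathcal H}\otimes\check{\mathcal H})$, $V:=U^{\check\rho}\in\mathcal U(\check{\mathcal H}\otimes\mathcal H)$, $W:=\check U^{\rho}\in\mathcal U(\mathcal H\otimes\check{\mathcal H})$. Then $U$ and $\check U$ are multiplicative unitaries, that is, $U_{23}U_{12}=U_{12}U_{13}U_{23}$ and $\check U_{23}\check U_{12}=\check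 U_{12}\check U_{13}\check U_{23}$, and \begin{alignat*}{2} U_{23}V_{12}&=V_{12}V_{13}U_{23},&\qquad \check U_{23}W_{12}&=W_{12}W_{13}\check U_{23},\\ V_{23}\check U_{12}&=\check U_{12}V_{13}V_{23},&\qquad W_{23}U_{12}&=U_{12}W_{13}W_{23},\\ V_{23}W_{12}&=W_{12}U_{13}V_{23},&\qquad W_{23}V_{12}&=V_{12}\check U_{13}W_{23}. \end{alignat*} If $U$ and $\check U$ are manageable (in the sense of Woronowicz), then $V$ is a morphism from the $C^*$-quantum group generated by $\check U$ to the one generated by $U$, $W$ is a morphism in the opposite direction, and these two morphisms are inverse to each other. Here $X\in\mathcal U(\mathcal K\otimes\mathcal K)$ is manageable if there are a positive self-adjoint operator $Q$ on $\mathcal K$ with $\ker Q=0$ and a unitary $\tilde X$ on $\overline{\mathcal K}\otimes\mathcal K$ with $X^*(Q\otimes Q)X=Q\otimes Q$ and $\langle x\otimes u, X(z\otimes y)\rangle=\langle\bar z\otimes Qu,\tilde X(\bar x\otimes Q^{-1}y)\rangle$ for all $x,z\in\mathcal K$, $u\in\operatorname{dom}Q$, $y\in\operatorname{dom}Q^{-1}$.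 A manageable multiplicative unitary $X\in\mathcal U(\mathcal K\otimes\mathcal K)$ generates the $C^*$-quantum group $(A_X,\Delta_X)$, where $A_X\subseteq\mathbb B(\mathcal K)$ is the closed linear span of $(\omega\otimes\mathrm{id})(X)$, $\omega\in\mathbb B(\mathcal K)_*$, and $\Delta_X(a)=X(a\otimes1)X^*$; its dual is $(\hat A_X,\hat\Delta_X)$, where $\hat A_X$ is the closed linear span of $(\mathrm{id}\otimes\omega)(X)$ and $\hat\Delta_X(a)=\Sigma X^*(1\otimes a)X\Sigma$ with the flip $\Sigma$. A morphism from $(A_X,\Delta_X)$ to $(A_Y,\Delta_Y)$ is a bicharacter, that is, a unitary multiplier $T$ of $\hat A_X\otimes A_Y$ with $(\hat\Delta_X\otimes\mathrm{id})(T)=T_{23}T_{13}$ and $(\mathrm{id}\otimes\Delta_Y)(T)=T_{12}T_{13}$. A bicharacter $T''$ from $X$ to $Z$ is the composition of bicharacters $T$ from $X$ to $Y$ and $T'$ from $Y$ to $Z$ if $T'_{23}T_{12}=T_{12}T''_{13}T'_{23}$; the identity morphism on $(A_X,\Delta_X)$ is $X$. -/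

import Mathlib

open scoped TensorProduct InnerProductSpace

universe u v

noncomputable section

namespace HilbertQG

/-! ### The tensor product of Hilbert spaces -/

/-- The Hilbert space tensor product: the completion of the algebraic tensor product for the inner
product determined by `⟪h ⊗ k, h' ⊗ k'⟫ = ⟪h, h'⟫ * ⟪k, k'⟫`. -/
def HTensor (H K : Type*) [NormedAddCommGroup H] [InnerProductSpace ℂ H]
    [NormedAddCommGroup K] [InnerProductSpace ℂ K] : Type _ :=
  UniformSpace.Completion (H ⊗[ℂ] K)

infixl:70 " ⊗ₕ " => HTensor

section Instances

variable (H K : Type*) [NormedAddCommGroup H] [InnerProductSpace ℂ H]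
  [NormedAddCommGroup K] [InnerProductSpace ℂ K]

instance : NormedAddCommGroup (H ⊗ₕ K) :=
  inferInstanceAs (NormedAddCommGroup (UniformSpace.Completion (H ⊗[ℂ] K)))

instance : InnerProductSpace ℂ (H ⊗ₕ K) :=
  inferInstanceAs (InnerProductSpace ℂ (UniformSpace.Completion (H ⊗[ℂ] K)))

instance : CompleteSpace (H ⊗ₕ K) :=
  inferInstanceAs (CompleteSpace (UniformSpace.Completion (H ⊗[ℂ] K)))

end Instances

section Tensor

variable {H K L H' K' E : Type*}
  [NormedAddCommGroup H] [InnerProductSpace ℂ H]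
  [NormedAddCommGroup K] [InnerProductSpace ℂ K]
  [NormedAddCommGroup L] [InnerProductSpace ℂ L]
  [NormedAddCommGroup H'] [InnerProductSpace ℂ H']
  [NormedAddCommGroup K'] [InnerProductSpace ℂ K']
  [NormedAddCommGroup E] [InnerProductSpace ℂ E]

variable (H K) in
/-- The inclusion of the algebraic tensor product. -/
def ofAlg : H ⊗[ℂ] K →ₗᵢ[ℂ] H ⊗ₕ K :=
  (UniformSpace.Completion.toComplₗᵢ : H ⊗[ℂ] K →ₗᵢ[ℂ] UniformSpace.Completion (H ⊗[ℂ] K))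

/-- The elementary tensor `h ⊗ k`. -/
def tmul (h : H) (k : K) : H ⊗ₕ K := ofAlg H K (h ⊗ₜ[ℂ] k)

lemma htensor_induction {p : H ⊗ₕ K → Prop} (hp : IsClosed {x | p x}) (h0 : p 0)
    (ht : ∀ h k, p (tmul h k)) (ha : ∀ x y, p x → p y → p (x + y)) (x : H ⊗ₕ K) : p x := by
  refine UniformSpace.Completion.induction_on (p := p) x hp (fun a => ?_)
  change p (ofAlg H K a)
  induction a using TensorProduct.induction_on with
  | zero => rwa [map_zero]
  | tmul h k => exact ht h k
  | add a b h₁ h₂ => rw [map_add]; exact ha _ _ h₁ h₂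

/-- The operator `K → H ⊗ K`, `k ↦ h ⊗ k`. -/
def ketLeft (K : Type*) [NormedAddCommGroup K] [InnerProductSpace ℂ K] (h : H) :
    K →L[ℂ] H ⊗ₕ K :=
  (ofAlg H K).toContinuousLinearMap.comp (TensorProduct.mkL ℂ H K h)

/-- The operator `H → H ⊗ K`, `h ↦ h ⊗ k`. -/
def ketRight (H : Type*) [NormedAddCommGroup H] [InnerProductSpace ℂ H] (k : K) :
    H →L[ℂ] H ⊗ₕ K :=
  (ofAlg H K).toContinuousLinearMap.comp ((TensorProduct.mkL ℂ H K).flip k)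

/-- The tensor product `f ⊗ g` of two bounded operators. -/
def tmap (f : H →L[ℂ] H') (g : K →L[ℂ] K') : H ⊗ₕ K →L[ℂ] H' ⊗ₕ K' :=
  ((TensorProduct.mapL f g).completion :
    UniformSpace.Completion (H ⊗[ℂ] K) →L[ℂ] UniformSpace.Completion (H' ⊗[ℂ] K'))

@[simp] lemma ketLeft_apply (h : H) (k : K) : ketLeft K h k = tmul h k := rfl

@[simp] lemma ketRight_apply (h : H) (k : K) : ketRight H k h = tmul h k := rfl

@[simp] lemma tmap_tmul (f : H →L[ℂ] H') (g : K →L[ℂ] K') (h : H) (k : K) :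
    tmap f g (tmul h k) = tmul (f h) (g k) :=
  ContinuousLinearMap.completion_apply_coe (TensorProduct.mapL f g) (h ⊗ₜ[ℂ] k)

@[simp] lemma inner_tmul (h h' : H) (k k' : K) :
    ⟪tmul h k, tmul h' k'⟫_ℂ = ⟪h, h'⟫_ℂ * ⟪k, k'⟫_ℂ := by
  simp [tmul]

/-- Bounded operators on `H ⊗ K` are determined by their values on elementary tensors. -/
lemma clm_ext {f g : H ⊗ₕ K →L[ℂ] E} (hfg : ∀ h k, f (tmul h k) = g (tmul h k)) : f = g := by
  ext x
  induction x using htensor_induction with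
  | hp => exact isClosed_eq f.continuous g.continuous
  | h0 => simp
  | ht h k => exact hfg h k
  | ha x y hx hy => rw [map_add, map_add, hx, hy]

/-- A bilinear map that multiplies inner products extends to an isometry on the Hilbert space tensor
product. -/
def liftIsometry [CompleteSpace E] (f : H →ₗ[ℂ] K →ₗ[ℂ] E)
    (hf : ∀ h h' k k', ⟪f h k, f h' k'⟫_ℂ = ⟪h, h'⟫_ℂ * ⟪k, k'⟫_ℂ) : H ⊗ₕ K →ₗᵢ[ℂ] E :=
  let g : H ⊗[ℂ] K →ₗᵢ[ℂ] E := (TensorProduct.lift f).isometryOfInner (fun x y => by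
    induction x using TensorProduct.induction_on with
    | zero => simp
    | add a b ha hb => simp only [map_add, inner_add_left, ha, hb]
    | tmul h k =>
      induction y using TensorProduct.induction_on with
      | zero => simp
      | add a b ha hb => simp only [map_add, inner_add_right, ha, hb]
      | tmul h' k' => simp [hf])
  let G : UniformSpace.Completion (H ⊗[ℂ] K) →L[ℂ] E := g.toContinuousLinearMap.fromCompletion
  { toLinearMap := G.toLinearMap
    norm_map' := fun x =>
      UniformSpace.Completion.induction_on (p := fun x => ‖G x‖ = ‖x‖) x
        (isClosed_eq (continuous_norm.comp G.continuous) continuous_norm)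
        (fun a => by simp [G]) }

@[simp] lemma liftIsometry_tmul [CompleteSpace E] (f : H →ₗ[ℂ] K →ₗ[ℂ] E) (hf) (h : H) (k : K) :
    liftIsometry f hf (tmul h k) = f h k :=
  ContinuousLinearMap.fromCompletion_apply_coe _ (h ⊗ₜ[ℂ] k)

/-- Two isometries that are inverse to each other, as an isometric isomorphism. -/
def isoOfInverse {E F : Type*} [NormedAddCommGroup E] [InnerProductSpace ℂ E]
    [NormedAddCommGroup F] [InnerProductSpace ℂ F] (f : E →ₗᵢ[ℂ] F) (g : F →ₗᵢ[ℂ] E)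
    (hfg : f.toContinuousLinearMap.comp g.toContinuousLinearMap = .id ℂ F)
    (hgf : g.toContinuousLinearMap.comp f.toContinuousLinearMap = .id ℂ E) : E ≃ₗᵢ[ℂ] F where
  toLinearEquiv := LinearEquiv.ofLinearMap f.toLinearMap g.toLinearMap
    (LinearMap.ext fun x => DFunLike.congr_fun hfg x)
    (LinearMap.ext fun x => DFunLike.congr_fun hgf x)
  norm_map' := f.norm_map

@[simp] lemma isoOfInverse_apply {E F : Type*} [NormedAddCommGroup E] [InnerProductSpace ℂ E]
    [NormedAddCommGroup F] [InnerProductSpace ℂ F] (f : E →ₗᵢ[ℂ] F) (g : F →ₗᵢ[ℂ] E)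
    (hfg) (hgf) (x : E) : isoOfInverse f g hfg hgf x = f x := rfl

@[simp] lemma isoOfInverse_symm_apply {E F : Type*} [NormedAddCommGroup E] [InnerProductSpace ℂ E]
    [NormedAddCommGroup F] [InnerProductSpace ℂ F] (f : E →ₗᵢ[ℂ] F) (g : F →ₗᵢ[ℂ] E)
    (hfg) (hgf) (y : F) : (isoOfInverse f g hfg hgf).symm y = g y := rfl

lemma tmul_add (h : H) (k k' : K) : tmul h (k + k') = tmul h k + tmul h k' :=
  (ketLeft K h).map_add k k'

lemma tmul_smul (c : ℂ) (h : H) (k : K) : tmul h (c • k) = c • tmul h k :=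
  (ketLeft K h).map_smul c k

lemma add_tmul (h h' : H) (k : K) : tmul (h + h') k = tmul h k + tmul h' k :=
  (ketRight H k).map_add h h'

lemma smul_tmul (c : ℂ) (h : H) (k : K) : tmul (c • h) k = c • tmul h k :=
  (ketRight H k).map_smul c h

variable (H K) in
/-- One half of the flip. -/
def commAux : H ⊗ₕ K →ₗᵢ[ℂ] K ⊗ₕ H :=
  liftIsometry (LinearMap.mk₂ ℂ (fun h k => tmul k h) (fun _ _ _ => tmul_add _ _ _)
    (fun _ _ _ => tmul_smul _ _ _) (fun _ _ _ => add_tmul _ _ _) (fun _ _ _ => smul_tmul _ _ _))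
    (fun h h' k k' => by simp [mul_comm])

variable (H K) in
/-- The flip `Σ : H ⊗ K → K ⊗ H`, `h ⊗ k ↦ k ⊗ h`. -/
def flip : H ⊗ₕ K ≃ₗᵢ[ℂ] K ⊗ₕ H :=
  isoOfInverse (commAux H K) (commAux K H)
    (clm_ext fun h k => by simp [commAux]) (clm_ext fun h k => by simp [commAux])

@[simp] lemma flip_tmul (h : H) (k : K) : flip H K (tmul h k) = tmul k h := by
  simp [flip, commAux]

/-- Two continuous functions on `H ⊗ K` that are additive agree if they do so on elementary
tensors. -/
lemma eq_of_tmul {A : Type*} [AddCommGroup A] [TopologicalSpace A] [T2Space A]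
    (f g : H ⊗ₕ K →+ A) (hf : Continuous f) (hg : Continuous g)
    (hfg : ∀ h k, f (tmul h k) = g (tmul h k)) (x : H ⊗ₕ K) : f x = g x := by
  induction x using htensor_induction with
  | hp => exact isClosed_eq hf hg
  | h0 => simp
  | ht h k => exact hfg h k
  | ha x y hx hy => rw [map_add, map_add, hx, hy]

/-- Inner products of images under two operators, computed on elementary tensors. -/
lemma inner_ext (f g : H ⊗ₕ K →L[ℂ] E) (c : ℂ)
    (hfg : ∀ h k h' k', ⟪f (tmul h k), g (tmul h' k')⟫_ℂ = ⟪tmul h k, tmul h' k'⟫_ℂ * c)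
    (x y : H ⊗ₕ K) : ⟪f x, g y⟫_ℂ = ⟪x, y⟫_ℂ * c := by
  refine eq_of_tmul
    ⟨⟨fun y => ⟪f x, g y⟫_ℂ, by simp⟩, fun a b => by simp only [map_add, inner_add_right]⟩
    ⟨⟨fun y => ⟪x, y⟫_ℂ * c, by simp⟩, fun a b => by simp only [inner_add_right, add_mul]⟩
    (Continuous.inner continuous_const g.continuous)
    ((Continuous.inner continuous_const continuous_id).mul continuous_const) (fun h' k' => ?_) y
  exact eq_of_tmul
    ⟨⟨fun x => ⟪f x, g (tmul h' k')⟫_ℂ, by simp⟩, fun a b => by simp only [map_add, inner_add_left]⟩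
    ⟨⟨fun x => ⟪x, tmul h' k'⟫_ℂ * c, by simp⟩, fun a b => by simp only [inner_add_left, add_mul]⟩
    (Continuous.inner f.continuous continuous_const)
    ((Continuous.inner continuous_id continuous_const).mul continuous_const)
    (fun h k => hfg h k h' k') x

variable (H K L) in
/-- One half of the associator. -/
def assocAux : (H ⊗ₕ K) ⊗ₕ L →ₗᵢ[ℂ] H ⊗ₕ (K ⊗ₕ L) :=
  liftIsometry (LinearMap.mk₂ ℂ (fun x l => tmap (.id ℂ H) (ketRight K l) x)
      (fun _ _ _ => map_add _ _ _) (fun _ _ _ => map_smul _ _ _)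
      (fun x l l' => DFunLike.congr_fun (f := tmap (.id ℂ H) (ketRight K (l + l')))
        (g := tmap (.id ℂ H) (ketRight K l) + tmap (.id ℂ H) (ketRight K l'))
        (clm_ext fun h k => by simp [tmul_add]) x)
      (fun c x l => DFunLike.congr_fun (f := tmap (.id ℂ H) (ketRight K (c • l)))
        (g := c • tmap (.id ℂ H) (ketRight K l)) (clm_ext fun h k => by simp [tmul_smul]) x))
    (fun x x' l l' => inner_ext (tmap (.id ℂ H) (ketRight K l)) (tmap (.id ℂ H) (ketRight K l'))
      ⟪l, l'⟫_ℂ (fun h k h' k' => by simp [mul_assoc]) x x')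

variable (H K L) in
/-- The other half of the associator. -/
def assocAuxInv : H ⊗ₕ (K ⊗ₕ L) →ₗᵢ[ℂ] (H ⊗ₕ K) ⊗ₕ L :=
  liftIsometry (LinearMap.mk₂ ℂ (fun h x => tmap (ketLeft K h) (.id ℂ L) x)
      (fun h h' x => DFunLike.congr_fun (f := tmap (ketLeft K (h + h')) (.id ℂ L))
        (g := tmap (ketLeft K h) (.id ℂ L) + tmap (ketLeft K h') (.id ℂ L))
        (clm_ext fun h k => by simp [add_tmul]) x)
      (fun c h x => DFunLike.congr_fun (f := tmap (ketLeft K (c • h)) (.id ℂ L))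
        (g := c • tmap (ketLeft K h) (.id ℂ L)) (clm_ext fun h k => by simp [smul_tmul]) x)
      (fun _ _ _ => map_add _ _ _) (fun _ _ _ => map_smul _ _ _))
    (fun h h' x x' => (inner_ext (tmap (ketLeft K h) (.id ℂ L)) (tmap (ketLeft K h') (.id ℂ L))
      ⟪h, h'⟫_ℂ (fun k l k' l' => by simp; ring) x x').trans (mul_comm _ _))

@[simp] lemma assocAux_tmul (h : H) (k : K) (l : L) :
    assocAux H K L (tmul (tmul h k) l) = tmul h (tmul k l) :=
  (liftIsometry_tmul _ _ _ _).trans (by simp)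

@[simp] lemma assocAuxInv_tmul (h : H) (k : K) (l : L) :
    assocAuxInv H K L (tmul h (tmul k l)) = tmul (tmul h k) l :=
  (liftIsometry_tmul _ _ _ _).trans (by simp)

/-- Bounded operators on `(H ⊗ K) ⊗ L` are determined by their values on elementary tensors. -/
lemma clm_ext₃ {f g : (H ⊗ₕ K) ⊗ₕ L →L[ℂ] E}
    (hfg : ∀ h k l, f (tmul (tmul h k) l) = g (tmul (tmul h k) l)) : f = g :=
  clm_ext fun x l => DFunLike.congr_fun (f := f.comp (ketRight _ l)) (g := g.comp (ketRight _ l))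
    (clm_ext fun h k => hfg h k l) x

/-- Bounded operators on `H ⊗ (K ⊗ L)` are determined by their values on elementary tensors. -/
lemma clm_ext₃' {f g : H ⊗ₕ (K ⊗ₕ L) →L[ℂ] E}
    (hfg : ∀ h k l, f (tmul h (tmul k l)) = g (tmul h (tmul k l))) : f = g :=
  clm_ext fun h x => DFunLike.congr_fun (f := f.comp (ketLeft _ h)) (g := g.comp (ketLeft _ h))
    (clm_ext fun k l => hfg h k l) x

variable (H K L) in
/-- The associator `(H ⊗ K) ⊗ L ≅ H ⊗ (K ⊗ L)`. -/
def assoc : (H ⊗ₕ K) ⊗ₕ L ≃ₗᵢ[ℂ] H ⊗ₕ (K ⊗ₕ L) :=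
  isoOfInverse (assocAux H K L) (assocAuxInv H K L)
    (clm_ext₃' fun h k l => by simp) (clm_ext₃ fun h k l => by simp)

@[simp] lemma assoc_tmul (h : H) (k : K) (l : L) :
    assoc H K L (tmul (tmul h k) l) = tmul h (tmul k l) := by
  simp [assoc]

@[simp] lemma assoc_symm_tmul (h : H) (k : K) (l : L) :
    (assoc H K L).symm (tmul h (tmul k l)) = tmul (tmul h k) l := by
  simp [assoc]

end Tensor

/-! ### The tensor unit -/

/-- The tensor unit: the one-dimensional Hilbert space of complex numbers, in any universe. -/
abbrev CUnit : Type u := ULift.{u} ℂ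

instance : InnerProductSpace ℂ CUnit.{u} where
  inner x y := ⟪x.down, y.down⟫_ℂ
  norm_sq_eq_re_inner x := norm_sq_eq_re_inner (𝕜 := ℂ) x.down
  conj_inner_symm x y := inner_conj_symm x.down y.down
  add_left x y z := inner_add_left x.down y.down z.down
  smul_left x y c := inner_smul_left x.down y.down c

section Unitors

variable (H : Type*) [NormedAddCommGroup H] [InnerProductSpace ℂ H] [CompleteSpace H]

/-- The map `ℂ ⊗ H → H`, `c ⊗ h ↦ c h`. -/
def leftUnitor : CUnit.{u} ⊗ₕ H →ₗᵢ[ℂ] H :=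
  liftIsometry (LinearMap.mk₂ ℂ (fun c h => c.down • h) (fun _ _ _ => add_smul _ _ _)
    (fun _ _ _ => mul_smul _ _ _) (fun _ _ _ => smul_add _ _ _) (fun _ _ _ => smul_comm _ _ _))
    (fun c c' h h' => by
      change ⟪c.down • h, c'.down • h'⟫_ℂ = ⟪c.down, c'.down⟫_ℂ * _
      rw [inner_smul_left, inner_smul_right]; simp; ring)

/-- The map `H ⊗ ℂ → H`, `h ⊗ c ↦ c h`. -/
def rightUnitor : H ⊗ₕ CUnit.{u} →ₗᵢ[ℂ] H :=
  (leftUnitor.{u} H).comp (flip H CUnit.{u}).toLinearIsometry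

end Unitors
/-! ### Leg numbering -/

section Legs

variable {H K L : Type*}
  [NormedAddCommGroup H] [InnerProductSpace ℂ H]
  [NormedAddCommGroup K] [InnerProductSpace ℂ K]
  [NormedAddCommGroup L] [InnerProductSpace ℂ L]

variable (L) in
/-- `T₁₂ = T ⊗ id` on `H ⊗ K ⊗ L`. -/
def leg12 (T : H ⊗ₕ K →L[ℂ] H ⊗ₕ K) : (H ⊗ₕ K) ⊗ₕ L →L[ℂ] (H ⊗ₕ K) ⊗ₕ L :=
  tmap T (.id ℂ L)

variable (H) in
/-- `T₂₃ = id ⊗ T` on `H ⊗ K ⊗ L`. -/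
def leg23 (T : K ⊗ₕ L →L[ℂ] K ⊗ₕ L) : (H ⊗ₕ K) ⊗ₕ L →L[ℂ] (H ⊗ₕ K) ⊗ₕ L :=
  ((assoc H K L).symm : H ⊗ₕ (K ⊗ₕ L) →L[ℂ] (H ⊗ₕ K) ⊗ₕ L) ∘L tmap (.id ℂ H) T ∘L
    (assoc H K L : (H ⊗ₕ K) ⊗ₕ L →L[ℂ] H ⊗ₕ (K ⊗ₕ L))

variable (H K L) in
/-- `Σ₂₃ : H ⊗ K ⊗ L → H ⊗ L ⊗ K`. -/
def flip23 : (H ⊗ₕ K) ⊗ₕ L →L[ℂ] (H ⊗ₕ L) ⊗ₕ K :=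
  ((assoc H L K).symm : H ⊗ₕ (L ⊗ₕ K) →L[ℂ] (H ⊗ₕ L) ⊗ₕ K) ∘L
    tmap (.id ℂ H) (flip K L : K ⊗ₕ L →L[ℂ] L ⊗ₕ K) ∘L
    (assoc H K L : (H ⊗ₕ K) ⊗ₕ L →L[ℂ] H ⊗ₕ (K ⊗ₕ L))

variable (K) in
/-- `T₁₃ = Σ₂₃ T₁₂ Σ₂₃` on `H ⊗ K ⊗ L`. -/
def leg13 (T : H ⊗ₕ L →L[ℂ] H ⊗ₕ L) : (H ⊗ₕ K) ⊗ₕ L →L[ℂ] (H ⊗ₕ K) ⊗ₕ L :=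
  flip23 H L K ∘L leg12 K T ∘L flip23 H K L

end Legs

/-! ### Hilbert space tensor categories and natural right absorbers -/

/-- A Hilbert space tensor category `𝒞`, with its faithful strict monoidal forgetful functor
`For : 𝒞 → Hilb` and the strict monoidal functor `τ : Hilb → 𝒞`, `For ∘ τ = id`.

The objects are presented by the fibres of `For` on objects: `Obj H` is the collection of the
objects `x` of `𝒞` with `For x = H` ("Hilbert spaces with extra structure"). As `For` is faithful,
arrows are bounded operators between the underlying Hilbert spaces, and all equations between
arrows are equations between operators. -/
structure HilbertTensorCategory where
  /-- The objects `x` with `For x = H`. -/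
  Obj : ∀ (H : Type u) [NormedAddCommGroup H] [InnerProductSpace ℂ H] [CompleteSpace H], Type v
  /-- The operators that come from `𝒞`. -/
  Hom : ∀ {H K : Type u} [NormedAddCommGroup H] [InnerProductSpace ℂ H] [CompleteSpace H]
    [NormedAddCommGroup K] [InnerProductSpace ℂ K] [CompleteSpace K],
    Obj H → Obj K → Submodule ℂ (H →L[ℂ] K)
  id_mem : ∀ {H : Type u} [NormedAddCommGroup H] [InnerProductSpace ℂ H] [CompleteSpace H]
    (x : Obj H), ContinuousLinearMap.id ℂ H ∈ Hom x x
  comp_mem : ∀ {H K L : Type u} [NormedAddCommGroup H] [InnerProductSpace ℂ H] [CompleteSpace H]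
    [NormedAddCommGroup K] [InnerProductSpace ℂ K] [CompleteSpace K]
    [NormedAddCommGroup L] [InnerProductSpace ℂ L] [CompleteSpace L]
    {x : Obj H} {y : Obj K} {z : Obj L} {b : K →L[ℂ] L} {a : H →L[ℂ] K},
    b ∈ Hom y z → a ∈ Hom x y → b ∘L a ∈ Hom x z
  adjoint_mem : ∀ {H K : Type u} [NormedAddCommGroup H] [InnerProductSpace ℂ H] [CompleteSpace H]
    [NormedAddCommGroup K] [InnerProductSpace ℂ K] [CompleteSpace K]
    {x : Obj H} {y : Obj K} {a : H →L[ℂ] K}, a ∈ Hom x y → a.adjoint ∈ Hom y x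
  /-- `𝒞` is a `W*`-category: its spaces of arrows are weakly closed. -/
  isClosed_hom : ∀ {H K : Type u} [NormedAddCommGroup H] [InnerProductSpace ℂ H] [CompleteSpace H]
    [NormedAddCommGroup K] [InnerProductSpace ℂ K] [CompleteSpace K] (x : Obj H) (y : Obj K),
    IsClosed {T : H →WOT[ℂ] K | T.toCLM ∈ Hom x y}
  /-- The tensor product of objects, with `For (x ⊗ y) = For x ⊗ For y`. -/
  tensor : ∀ {H K : Type u} [NormedAddCommGroup H] [InnerProductSpace ℂ H] [CompleteSpace H]
    [NormedAddCommGroup K] [InnerProductSpace ℂ K] [CompleteSpace K],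
    Obj H → Obj K → Obj (H ⊗ₕ K)
  tmap_mem : ∀ {H K H' K' : Type u}
    [NormedAddCommGroup H] [InnerProductSpace ℂ H] [CompleteSpace H]
    [NormedAddCommGroup K] [InnerProductSpace ℂ K] [CompleteSpace K]
    [NormedAddCommGroup H'] [InnerProductSpace ℂ H'] [CompleteSpace H']
    [NormedAddCommGroup K'] [InnerProductSpace ℂ K'] [CompleteSpace K']
    {x : Obj H} {y : Obj K} {x' : Obj H'} {y' : Obj K'} {a : H →L[ℂ] H'} {b : K →L[ℂ] K'},
    a ∈ Hom x x' → b ∈ Hom y y' → tmap a b ∈ Hom (tensor x y) (tensor x' y')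
  /-- The trivial object `τ H`. -/
  triv : ∀ (H : Type u) [NormedAddCommGroup H] [InnerProductSpace ℂ H] [CompleteSpace H], Obj H
  triv_hom : ∀ {H K : Type u} [NormedAddCommGroup H] [InnerProductSpace ℂ H] [CompleteSpace H]
    [NormedAddCommGroup K] [InnerProductSpace ℂ K] [CompleteSpace K] (a : H →L[ℂ] K),
    a ∈ Hom (triv H) (triv K)
  triv_tensor : ∀ (H K : Type u) [NormedAddCommGroup H] [InnerProductSpace ℂ H] [CompleteSpace H]
    [NormedAddCommGroup K] [InnerProductSpace ℂ K] [CompleteSpace K],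
    triv (H ⊗ₕ K) = tensor (triv H) (triv K)
  /-- The associator of `𝒞` is that of `Hilb`. (Its inverse, being its adjoint, is an arrow too.) -/
  assoc_mem : ∀ {H K L : Type u} [NormedAddCommGroup H] [InnerProductSpace ℂ H] [CompleteSpace H]
    [NormedAddCommGroup K] [InnerProductSpace ℂ K] [CompleteSpace K]
    [NormedAddCommGroup L] [InnerProductSpace ℂ L] [CompleteSpace L]
    (x : Obj H) (y : Obj K) (z : Obj L),
    (assoc H K L : (H ⊗ₕ K) ⊗ₕ L →L[ℂ] H ⊗ₕ (K ⊗ₕ L)) ∈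
      Hom (tensor (tensor x y) z) (tensor x (tensor y z))
  /-- The tensor unit is `τ ℂ`, with the unit transformations of `Hilb`. -/
  leftUnitor_mem : ∀ {H : Type u} [NormedAddCommGroup H] [InnerProductSpace ℂ H] [CompleteSpace H]
    (x : Obj H),
    (leftUnitor.{u} H).toContinuousLinearMap ∈ Hom (tensor (triv CUnit.{u}) x) x
  rightUnitor_mem : ∀ {H : Type u} [NormedAddCommGroup H] [InnerProductSpace ℂ H] [CompleteSpace H]
    (x : Obj H),
    (rightUnitor.{u} H).toContinuousLinearMap ∈ Hom (tensor x (triv CUnit.{u})) x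
  /-- Objects joined by the identity operator are equal. -/
  eq_of_id_mem : ∀ {H : Type u} [NormedAddCommGroup H] [InnerProductSpace ℂ H] [CompleteSpace H]
    {x x' : Obj H}, ContinuousLinearMap.id ℂ H ∈ Hom x x' → x = x'
  /-- Cancellation on the right. The object `y` has to be nonzero, because `a ⊗ id` is always an
  arrow if `y` lives on the zero Hilbert space. -/
  cancel_right : ∀ {H K L : Type u} [NormedAddCommGroup H] [InnerProductSpace ℂ H] [CompleteSpace H]
    [NormedAddCommGroup K] [InnerProductSpace ℂ K] [CompleteSpace K]
    [NormedAddCommGroup L] [InnerProductSpace ℂ L] [CompleteSpace L] [Nontrivial L]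
    {x : Obj H} {x' : Obj K} (y : Obj L) {a : H →L[ℂ] K},
    tmap a (.id ℂ L) ∈ Hom (tensor x y) (tensor x' y) → a ∈ Hom x x'
  /-- Cancellation on the left. -/
  cancel_left : ∀ {H K L : Type u} [NormedAddCommGroup H] [InnerProductSpace ℂ H] [CompleteSpace H]
    [NormedAddCommGroup K] [InnerProductSpace ℂ K] [CompleteSpace K]
    [NormedAddCommGroup L] [InnerProductSpace ℂ L] [CompleteSpace L] [Nontrivial L]
    {x : Obj H} {x' : Obj K} (y : Obj L) {a : H →L[ℂ] K},
    tmap (.id ℂ L) a ∈ Hom (tensor y x) (tensor y x') → a ∈ Hom x x'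

/-- The structure of a natural right absorber on an object `ρ` of `𝒞`: natural unitary arrows
`Uˣ : x ⊗ ρ → τ(x) ⊗ ρ`, compatible with tensor products. -/
structure NaturalRightAbsorber (C : HilbertTensorCategory.{u, v}) {H : Type u}
    [NormedAddCommGroup H] [InnerProductSpace ℂ H] [CompleteSpace H] (ρ : C.Obj H) where
  /-- The unitaries `Uˣ`. -/
  U : ∀ {K : Type u} [NormedAddCommGroup K] [InnerProductSpace ℂ K] [CompleteSpace K]
    (_x : C.Obj K), K ⊗ₕ H →L[ℂ] K ⊗ₕ H
  unitary_mem : ∀ {K : Type u} [NormedAddCommGroup K] [InnerProductSpace ℂ K] [CompleteSpace K]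
    (x : C.Obj K), U x ∈ unitary (K ⊗ₕ H →L[ℂ] K ⊗ₕ H)
  hom_mem : ∀ {K : Type u} [NormedAddCommGroup K] [InnerProductSpace ℂ K] [CompleteSpace K]
    (x : C.Obj K), U x ∈ C.Hom (C.tensor x ρ) (C.tensor (C.triv K) ρ)
  natural : ∀ {K L : Type u} [NormedAddCommGroup K] [InnerProductSpace ℂ K] [CompleteSpace K]
    [NormedAddCommGroup L] [InnerProductSpace ℂ L] [CompleteSpace L]
    {x : C.Obj K} {y : C.Obj L} {a : K →L[ℂ] L}, a ∈ C.Hom x y →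
    U y ∘L tmap a (.id ℂ H) = tmap a (.id ℂ H) ∘L U x
  tensor_eq : ∀ {K L : Type u} [NormedAddCommGroup K] [InnerProductSpace ℂ K] [CompleteSpace K]
    [NormedAddCommGroup L] [InnerProductSpace ℂ L] [CompleteSpace L]
    (x : C.Obj K) (y : C.Obj L),
    U (C.tensor x y) = leg13 L (U x) ∘L leg23 K (U y)

/-! ### Multiplicative unitaries and manageability -/

/-- The complex conjugate `H̄` of a Hilbert space `H`: the same additive group, with scalar
multiplication `c • x̄ = (c̄ • x)‾` and inner product `⟪x̄, ȳ⟫ = ⟪y, x⟫`. -/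
def ConjSpace (H : Type*) : Type _ := H

/-- The conjugate-linear identification `x ↦ x̄`. -/
def toConj {H : Type*} (x : H) : ConjSpace H := x

/-- The inverse of `x ↦ x̄`. -/
def ofConj {H : Type*} (x : ConjSpace H) : H := x

section Manageable

variable {H : Type*} [NormedAddCommGroup H] [InnerProductSpace ℂ H]

instance : NormedAddCommGroup (ConjSpace H) := inferInstanceAs (NormedAddCommGroup H)

instance : InnerProductSpace ℂ (ConjSpace H) where
  smul c x := toConj (starRingEnd ℂ c • ofConj x)
  one_smul x := show starRingEnd ℂ 1 • ofConj x = ofConj x by simp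
  mul_smul a b x := show starRingEnd ℂ (a * b) • ofConj x =
    starRingEnd ℂ a • starRingEnd ℂ b • ofConj x by simp [mul_smul]
  smul_zero a := show starRingEnd ℂ a • (0 : H) = 0 from smul_zero _
  smul_add a x y := show starRingEnd ℂ a • (ofConj x + ofConj y) = _ from smul_add _ _ _
  add_smul a b x := show starRingEnd ℂ (a + b) • ofConj x =
    starRingEnd ℂ a • ofConj x + starRingEnd ℂ b • ofConj x by simp [add_smul]
  zero_smul x := show starRingEnd ℂ 0 • ofConj x = (0 : H) by simp
  norm_smul_le a x := show ‖starRingEnd ℂ a • ofConj x‖ ≤ ‖a‖ * ‖ofConj x‖ by simp [norm_smul]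
  inner x y := ⟪ofConj y, ofConj x⟫_ℂ
  norm_sq_eq_re_inner x := norm_sq_eq_re_inner (𝕜 := ℂ) (ofConj x)
  conj_inner_symm x y := inner_conj_symm (ofConj y) (ofConj x)
  add_left x y z := inner_add_right (ofConj z) (ofConj x) (ofConj y)
  smul_left x y c := inner_smul_right (ofConj y) (ofConj x) (starRingEnd ℂ c)

/-- A multiplicative unitary: a unitary with the pentagon equation `W₂₃ W₁₂ = W₁₂ W₁₃ W₂₃`. -/
structure IsMultiplicativeUnitary (W : H ⊗ₕ H →L[ℂ] H ⊗ₕ H) : Prop where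
  unitary_mem : W ∈ unitary (H ⊗ₕ H →L[ℂ] H ⊗ₕ H)
  pentagon : leg23 H W * leg12 H W = leg12 H W * leg13 H W * leg23 H W

/-- The graph of `Q ⊗ Q`, the closure of the operator `u ⊗ v ↦ Q u ⊗ Q v` on the algebraic tensor
product of the domains. -/
def tensorSquareGraph (Q : H →ₗ.[ℂ] H) : Submodule ℂ ((H ⊗ₕ H) × (H ⊗ₕ H)) :=
  (Submodule.span ℂ (Set.range fun p : Q.domain × Q.domain =>
    (tmul (p.1 : H) (p.2 : H), tmul (Q p.1) (Q p.2)))).topologicalClosure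

/-- Manageability of a multiplicative unitary `W` on `H ⊗ H` (Woronowicz): there are a positive
self-adjoint operator `Q` on `H` with trivial kernel and a unitary `W̃` on `H̄ ⊗ H` with
`W* (Q ⊗ Q) W = Q ⊗ Q` and `⟪x ⊗ u, W (z ⊗ y)⟫ = ⟪z̄ ⊗ Q u, W̃ (x̄ ⊗ Q⁻¹ y)⟫` for all `x, z ∈ H`,
`u ∈ dom Q`, `y ∈ dom Q⁻¹`; the elements of `dom Q⁻¹` are written as `y = Q v` with
`v ∈ dom Q`. -/
def IsManageable [CompleteSpace H] (W : H ⊗ₕ H →L[ℂ] H ⊗ₕ H) : Prop :=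
  ∃ (Q : H →ₗ.[ℂ] H) (W' : ConjSpace H ⊗ₕ H →L[ℂ] ConjSpace H ⊗ₕ H),
    IsSelfAdjoint Q ∧ (∀ u : Q.domain, 0 ≤ (⟪(u : H), Q u⟫_ℂ).re) ∧
    (∀ u : Q.domain, Q u = 0 → u = 0) ∧
    W' ∈ unitary (ConjSpace H ⊗ₕ H →L[ℂ] ConjSpace H ⊗ₕ H) ∧
    (∀ ξ η : H ⊗ₕ H, (W ξ, W η) ∈ tensorSquareGraph Q ↔ (ξ, η) ∈ tensorSquareGraph Q) ∧
    ∀ (x z : H) (u v : Q.domain),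
      ⟪tmul x (u : H), W (tmul z (Q v))⟫_ℂ =
        ⟪tmul (toConj z) (Q u), W' (tmul (toConj x) (v : H))⟫_ℂ

end Manageable

/-! ### The quantum groups of manageable multiplicative unitaries and their morphisms -/

section QuantumGroup

variable {H K : Type*} [NormedAddCommGroup H] [InnerProductSpace ℂ H] [CompleteSpace H]
  [NormedAddCommGroup K] [InnerProductSpace ℂ K] [CompleteSpace K]

/-- The underlying `C*`-algebra `A ⊆ 𝔹(H)` of the quantum group `(A, Δ)` generated by `W`: the
norm-closed linear span of the slices `(ω ⊗ id) W` for normal functionals `ω` on `𝔹(H)`. It suffices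
to use the vector functionals `ω = ⟪x, · z⟫`, whose closed linear span is `𝔹(H)_*`; their slices
are the operators `(⟨x| ⊗ 1) W (|z⟩ ⊗ 1)`. -/
def quantumAlgebra (W : H ⊗ₕ H →L[ℂ] H ⊗ₕ H) : Submodule ℂ (H →L[ℂ] H) :=
  (Submodule.span ℂ (Set.range fun p : H × H =>
    (ketLeft H p.1).adjoint ∘L W ∘L ketLeft H p.2)).topologicalClosure

/-- The underlying `C*`-algebra `Â ⊆ 𝔹(H)` of the dual quantum group `(Â, Δ̂)`: the norm-closed
linear span of the slices `(id ⊗ ω) W`. -/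
def dualQuantumAlgebra (W : H ⊗ₕ H →L[ℂ] H ⊗ₕ H) : Submodule ℂ (H →L[ℂ] H) :=
  (Submodule.span ℂ (Set.range fun p : H × H =>
    (ketRight H p.1).adjoint ∘L W ∘L ketRight H p.2)).topologicalClosure

/-- The spatial tensor product `A ⊗ B ⊆ 𝔹(H ⊗ K)` of `A ⊆ 𝔹(H)` and `B ⊆ 𝔹(K)`. -/
def spatialTensor (A : Submodule ℂ (H →L[ℂ] H)) (B : Submodule ℂ (K →L[ℂ] K)) :
    Submodule ℂ (H ⊗ₕ K →L[ℂ] H ⊗ₕ K) :=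
  (Submodule.span ℂ (Set.range fun p : A × B =>
    tmap (p.1 : H →L[ℂ] H) (p.2 : K →L[ℂ] K))).topologicalClosure

/-- The multiplier algebra of a nondegenerate `C*`-algebra `A ⊆ 𝔹(H)`, as its idealiser. -/
def multipliers (A : Submodule ℂ (H →L[ℂ] H)) : Set (H →L[ℂ] H) :=
  {T | ∀ S ∈ A, T * S ∈ A ∧ S * T ∈ A}

/-- The comultiplication `Δ(a) = W (a ⊗ 1) W*` of the quantum group generated by `W`, applied to
the second leg: the strictly continuous extension of `b ⊗ a ↦ b ⊗ Δ(a)` to multipliers on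
`K ⊗ H` is `V ↦ W₂₃ V₁₂ W₂₃*`. -/
def comulSnd (W : H ⊗ₕ H →L[ℂ] H ⊗ₕ H) (V : K ⊗ₕ H →L[ℂ] K ⊗ₕ H) :
    (K ⊗ₕ H) ⊗ₕ H →L[ℂ] (K ⊗ₕ H) ⊗ₕ H :=
  leg23 K W * leg12 H V * (leg23 K W).adjoint

/-- The comultiplication `Δ̂(a) = Σ W* (1 ⊗ a) W Σ` of the dual quantum group, applied to the first
leg: the strictly continuous extension of `a ⊗ b ↦ Δ̂(a) ⊗ b` to multipliers on `H ⊗ K` is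
`V ↦ Σ₁₂ W₁₂* V₂₃ W₁₂ Σ₁₂`. -/
def dualComulFst (W : H ⊗ₕ H →L[ℂ] H ⊗ₕ H) (V : H ⊗ₕ K →L[ℂ] H ⊗ₕ K) :
    (H ⊗ₕ H) ⊗ₕ K →L[ℂ] (H ⊗ₕ H) ⊗ₕ K :=
  leg12 K (flip H H : H ⊗ₕ H →L[ℂ] H ⊗ₕ H) *
    ((leg12 K W).adjoint * leg23 H V * leg12 K W) *
    leg12 K (flip H H : H ⊗ₕ H →L[ℂ] H ⊗ₕ H)

/-- Morphisms of `C*`-quantum groups from `(C, Δ_C)`, generated by `X` on `H ⊗ H`, to `(A, Δ_A)`,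
generated by `Y` on `K ⊗ K`: bicharacters, that is, unitary multipliers `V` of `Ĉ ⊗ A` with
`(Δ̂_C ⊗ id) V = V₂₃ V₁₃` and `(id ⊗ Δ_A) V = V₁₂ V₁₃`. -/
structure IsBicharacter (X : H ⊗ₕ H →L[ℂ] H ⊗ₕ H) (Y : K ⊗ₕ K →L[ℂ] K ⊗ₕ K)
    (V : H ⊗ₕ K →L[ℂ] H ⊗ₕ K) : Prop where
  unitary_mem : V ∈ unitary (H ⊗ₕ K →L[ℂ] H ⊗ₕ K)
  mem_multipliers : V ∈ multipliers (spatialTensor (dualQuantumAlgebra X) (quantumAlgebra Y))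
  dualComul_eq : dualComulFst X V = leg23 H V * leg13 H V
  comul_eq : comulSnd Y V = leg12 K V * leg13 K V

/-- The bicharacter `V''` from `X` to `Z` is the composition of the bicharacters `V` from `X` to `Y`
and `V'` from `Y` to `Z`: this means `V'₂₃ V₁₂ = V₁₂ V''₁₃ V'₂₃`. -/
structure IsComposition {L : Type*} [NormedAddCommGroup L] [InnerProductSpace ℂ L] [CompleteSpace L]
    (X : H ⊗ₕ H →L[ℂ] H ⊗ₕ H) (Y : K ⊗ₕ K →L[ℂ] K ⊗ₕ K) (Z : L ⊗ₕ L →L[ℂ] L ⊗ₕ L)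
    (V : H ⊗ₕ K →L[ℂ] H ⊗ₕ K) (V' : K ⊗ₕ L →L[ℂ] K ⊗ₕ L) (V'' : H ⊗ₕ L →L[ℂ] H ⊗ₕ L) :
    Prop where
  fst : IsBicharacter X Y V
  snd : IsBicharacter Y Z V'
  comp : IsBicharacter X Z V''
  eq : leg23 H V' * leg12 L V = leg12 L V * leg13 K V'' * leg23 H V'

/-- `V` and `W` are morphisms from `X` to `Y` and from `Y` to `X` that are inverse to each other:
their compositions are the identity morphisms, which are the multiplicative unitaries `X` and
`Y` themselves, viewed as bicharacters. -/
structure AreInverseMorphisms (X : H ⊗ₕ H →L[ℂ] H ⊗ₕ H) (Y : K ⊗ₕ K →L[ℂ] K ⊗ₕ K)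
    (V : H ⊗ₕ K →L[ℂ] H ⊗ₕ K) (W : K ⊗ₕ H →L[ℂ] K ⊗ₕ H) : Prop where
  comp_fst : IsComposition X Y X V W X
  comp_snd : IsComposition Y X Y W V Y

end QuantumGroup

end HilbertQG

end

open HilbertQG

/-! All eight equations come from one computation. Let A and B be natural right absorbers on ρ and
σ. Naturality of B is applied to the arrow `A.U x` from x ⊗ ρ to τ(x) ⊗ ρ, and the tensor rule
expands B on both objects. B is trivial on τ(x): on the tensor unit it is an idempotent unitary,
hence 1, and naturality along ℂ → K carries this to every τ(K). What remains is `B.U(ρ)₂₃ A.U(x)₁₂ =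
A.U(x)₁₂ B.U(x)₁₃ B.U(ρ)₂₃` (`leg23_mul_leg12`). The choices of A, B, x give the pentagon equations
and the six mixed ones.

The two bicharacter identities are rearrangements of these equations, and the last two mixed
equations say that the compositions are identities. The analytic work is to show that `V` is a
multiplier of Â ⊗ A. For the algebra A of slices of W, consider the column module H ⊗ A, the closed
span of the operators |h⟩ ⊗ a. Slicing the pentagon equation (`map_slice_mem_iff`) exchanges the
operators W(|k⟩ ⊗ slice) with (T ⊗ 1) W (|z⟩ ⊗ 1), where T is a slice of ΣW*. Manageability rewrites
the latter through W̃ as columns of slices of W̃ (`IsManaged.tmap_slice_eq`), and these belong to A.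
Hence W(H ⊗ A) = H ⊗ A (`IsColumnStable`).

This stability alone yields A*A ⊆ A, A = A*, density of AA in A, and V(K ⊗ A) = K ⊗ A for every
unitary V adapted to W. The manageability data pass to ΣW*Σ, so the same holds for Â. Finally V₁₃ =
X₁₂* V₂₃ X₁₂ V₂₃*, where every factor preserves the closed span of the operators b ⊗ |h⟩ ⊗ a.
Slicing the idle middle leg gives V(Â ⊗ A) ⊆ Â ⊗ A (`isBicharacter_of_pentagon`). -/

set_option linter.unusedSectionVars false

noncomputable section

namespace HilbertQG

open ContinuousLinearMap

/-! ### Closed spans -/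

section ClosedSpan

variable {E F : Type*} [NormedAddCommGroup E] [NormedSpace ℂ E]
  [NormedAddCommGroup F] [NormedSpace ℂ F]

/-- A bounded (semilinear) operator that maps generators into a closed subspace maps their closed
span there. -/
lemma map_mem_of_closedSpan {σ : ℂ →+* ℂ} {S : Set E} (f : E →SL[σ] F) {N : Submodule ℂ F}
    (hN : IsClosed (N : Set F)) (h : ∀ x ∈ S, f x ∈ N) {x : E}
    (hx : x ∈ (Submodule.span ℂ S).topologicalClosure) : f x ∈ N := by
  have : (Submodule.span ℂ S).topologicalClosure ≤ N.comap f.toLinearMap :=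
    Submodule.topologicalClosure_minimal _ (Submodule.span_le.2 h) (hN.preimage f.continuous)
  exact this hx

lemma subset_closedSpan {S : Set E} {x : E} (hx : x ∈ S) :
    x ∈ (Submodule.span ℂ S).topologicalClosure :=
  Submodule.le_topologicalClosure _ (Submodule.subset_span hx)

/-- A continuous map that takes a dense set into a closed subspace takes everything there. -/
lemma map_mem_of_dense {E : Type*} [TopologicalSpace E] {S : Set E} (hS : Dense S)
    {f : E → F} (hf : Continuous f) {N : Submodule ℂ F} (hN : IsClosed (N : Set F)) (h : ∀ x ∈ S, f x ∈ N)
    (x : E) : f x ∈ N :=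
  hS.induction (P := fun x => f x ∈ N) h (hN.preimage hf) x

end ClosedSpan

/-! ### Calculus of operators on Hilbert space tensor products -/

section Calculus

variable {H K L H' K' L' H'' K'' E : Type*}
  [NormedAddCommGroup H] [InnerProductSpace ℂ H]
  [NormedAddCommGroup K] [InnerProductSpace ℂ K]
  [NormedAddCommGroup L] [InnerProductSpace ℂ L]
  [NormedAddCommGroup H'] [InnerProductSpace ℂ H']
  [NormedAddCommGroup K'] [InnerProductSpace ℂ K']
  [NormedAddCommGroup L'] [InnerProductSpace ℂ L']
  [NormedAddCommGroup H''] [InnerProductSpace ℂ H'']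
  [NormedAddCommGroup K''] [InnerProductSpace ℂ K'']

/-- A continuous linear map on `H ⊗ K` takes values in a closed subspace if it does so on
elementary tensors. -/
lemma map_mem_of_tmul [NormedAddCommGroup E] [NormedSpace ℂ E] (f : H ⊗ₕ K →L[ℂ] E)
    {N : Submodule ℂ E} (hN : IsClosed (N : Set E)) (h : ∀ x y, f (tmul x y) ∈ N)
    (ζ : H ⊗ₕ K) : f ζ ∈ N := by
  induction ζ using htensor_induction with
  | hp => exact hN.preimage f.continuous
  | h0 => simp
  | ht x y => exact h x y
  | ha x y hx hy => rw [map_add]; exact N.add_mem hx hy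

/-! ### Functoriality of the tensor product of operators -/

lemma tmap_comp (f : H' →L[ℂ] H'') (g : K' →L[ℂ] K'') (f' : H →L[ℂ] H') (g' : K →L[ℂ] K') :
    tmap f g ∘L tmap f' g' = tmap (f ∘L f') (g ∘L g') :=
  clm_ext fun h k => by simp

lemma tmap_tmap (f : H' →L[ℂ] H'') (g : K' →L[ℂ] K'') (f' : H →L[ℂ] H') (g' : K →L[ℂ] K')
    (ζ : H ⊗ₕ K) : tmap f g (tmap f' g' ζ) = tmap (f ∘L f') (g ∘L g') ζ :=
  DFunLike.congr_fun (tmap_comp f g f' g') ζ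

@[simp] lemma tmap_id : tmap (.id ℂ H) (.id ℂ K) = .id ℂ (H ⊗ₕ K) :=
  clm_ext fun h k => by simp

lemma norm_tmap_le (f : H →L[ℂ] H') (g : K →L[ℂ] K') : ‖tmap f g‖ ≤ ‖f‖ * ‖g‖ := by
  refine opNorm_le_bound _ (by positivity) fun x => ?_
  refine UniformSpace.Completion.induction_on
    (p := fun x => ‖tmap f g x‖ ≤ ‖f‖ * ‖g‖ * ‖x‖) x
    (isClosed_le (tmap f g).continuous.norm (continuous_const.mul continuous_norm)) fun a => ?_
  have h1 : tmap f g (ofAlg H K a) = ofAlg H' K' (TensorProduct.mapL f g a) :=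
    ContinuousLinearMap.completion_apply_coe (TensorProduct.mapL f g) a
  change ‖tmap f g (ofAlg H K a)‖ ≤ ‖f‖ * ‖g‖ * ‖ofAlg H K a‖
  rw [h1, LinearIsometry.norm_map, LinearIsometry.norm_map]
  exact (TensorProduct.mapL f g).le_of_opNorm_le (TensorProduct.norm_mapL_le f g) a

/-- The operator `f ↦ f ⊗ g`. -/
def tmapLeftL (H H' : Type*) [NormedAddCommGroup H] [InnerProductSpace ℂ H]
    [NormedAddCommGroup H'] [InnerProductSpace ℂ H'] (g : K →L[ℂ] K') :
    (H →L[ℂ] H') →L[ℂ] (H ⊗ₕ K →L[ℂ] H' ⊗ₕ K') :=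
  LinearMap.mkContinuous
    { toFun := fun f => tmap f g
      map_add' := fun f f' => clm_ext fun h k => by simp [add_tmul]
      map_smul' := fun c f => clm_ext fun h k => by simp [smul_tmul] }
    ‖g‖ fun f => (norm_tmap_le f g).trans_eq (mul_comm _ _)

/-- The operator `g ↦ f ⊗ g`. -/
def tmapRightL (K K' : Type*) [NormedAddCommGroup K] [InnerProductSpace ℂ K]
    [NormedAddCommGroup K'] [InnerProductSpace ℂ K'] (f : H →L[ℂ] H') :
    (K →L[ℂ] K') →L[ℂ] (H ⊗ₕ K →L[ℂ] H' ⊗ₕ K') :=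
  LinearMap.mkContinuous
    { toFun := fun g => tmap f g
      map_add' := fun g g' => clm_ext fun h k => by simp [tmul_add]
      map_smul' := fun c g => clm_ext fun h k => by simp [tmul_smul] }
    ‖f‖ fun g => norm_tmap_le f g

@[simp] lemma tmapRightL_apply (f : H →L[ℂ] H') (g : K →L[ℂ] K') :
    tmapRightL K K' f g = tmap f g := rfl

/-- The operator `h ↦ |h⟩ ⊗ 1`. -/
def ketLeftL (H K : Type*) [NormedAddCommGroup H] [InnerProductSpace ℂ H]
    [NormedAddCommGroup K] [InnerProductSpace ℂ K] : H →L[ℂ] (K →L[ℂ] H ⊗ₕ K) :=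
  (compL ℂ K (H ⊗[ℂ] K) (H ⊗ₕ K) (ofAlg H K).toContinuousLinearMap) ∘L TensorProduct.mkL ℂ H K

@[simp] lemma ketLeftL_apply (h : H) : ketLeftL H K h = ketLeft K h := rfl

/-- Vectors of `H ⊗ K` that have the same inner products with elementary tensors are equal. -/
lemma eq_of_inner_tmul {ξ η : H ⊗ₕ K} (h : ∀ x y, ⟪tmul x y, ξ⟫_ℂ = ⟪tmul x y, η⟫_ℂ) :
    ξ = η := by
  refine ext_inner_left ℂ fun ζ => ?_
  induction ζ using htensor_induction with
  | hp => exact isClosed_eq (by fun_prop) (by fun_prop)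
  | h0 => simp
  | ht x y => exact h x y
  | ha x y hx hy => rw [inner_add_left, inner_add_left, hx, hy]

lemma adjoint_eq_of_inner_tmul [CompleteSpace H] [CompleteSpace K] (f : H ⊗ₕ K →L[ℂ] H' ⊗ₕ K')
    (g : H' ⊗ₕ K' →L[ℂ] H ⊗ₕ K)
    (h : ∀ x y x' y', ⟪f (tmul x y), tmul x' y'⟫_ℂ = ⟪tmul x y, g (tmul x' y')⟫_ℂ) :
    f.adjoint = g :=
  clm_ext fun x' y' => eq_of_inner_tmul fun x y => by rw [adjoint_inner_right, h]

lemma tmap_adjoint [CompleteSpace H] [CompleteSpace K] [CompleteSpace H'] [CompleteSpace K']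
    (f : H →L[ℂ] H') (g : K →L[ℂ] K') : (tmap f g).adjoint = tmap f.adjoint g.adjoint :=
  adjoint_eq_of_inner_tmul _ _ fun x y x' y' => by simp [adjoint_inner_right]

lemma adjoint_id [CompleteSpace H] : (ContinuousLinearMap.id ℂ H).adjoint = .id ℂ H :=
  (ContinuousLinearMap.eq_adjoint_iff _ _).2 (fun _ _ => rfl) |>.symm

@[simp] lemma ketLeft_adjoint_tmul [CompleteSpace K] (x h : H) (k : K) :
    (ketLeft K x).adjoint (tmul h k) = ⟪x, h⟫_ℂ • k :=
  ext_inner_left ℂ fun y => by simp [adjoint_inner_right, inner_smul_right]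

@[simp] lemma ketRight_adjoint_tmul [CompleteSpace H] (x k : K) (h : H) :
    (ketRight H x).adjoint (tmul h k) = ⟪x, k⟫_ℂ • h :=
  ext_inner_left ℂ fun y => by simp [adjoint_inner_right, inner_smul_right, mul_comm]

lemma ketLeft_adjoint_comp_ketLeft [CompleteSpace K] (x h : H) :
    (ketLeft K x).adjoint ∘L ketLeft K h = ⟪x, h⟫_ℂ • .id ℂ K := by
  ext; simp

lemma ketRight_adjoint_comp_ketRight [CompleteSpace H] (x k : K) :
    (ketRight H x).adjoint ∘L ketRight H k = ⟪x, k⟫_ℂ • .id ℂ H := by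
  ext; simp

lemma tmap_comp_ketLeft (f : H →L[ℂ] H') (g : K →L[ℂ] K') (h : H) :
    tmap f g ∘L ketLeft K h = ketLeft K' (f h) ∘L g := by
  ext; simp

/-! ### Leg numbering -/

lemma assoc_symm_tmul_left (h : H) (ξ : K ⊗ₕ L) :
    (assoc H K L).symm (tmul h ξ) = tmap (ketLeft K h) (.id ℂ L) ξ :=
  DFunLike.congr_fun (f := ((assoc H K L).symm : H ⊗ₕ (K ⊗ₕ L) →L[ℂ] (H ⊗ₕ K) ⊗ₕ L) ∘L
    ketLeft (K ⊗ₕ L) h) (g := tmap (ketLeft K h) (.id ℂ L)) (clm_ext fun k l => by simp) ξ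

@[simp] lemma flip23_tmul (h : H) (k : K) (l : L) :
    flip23 H K L (tmul (tmul h k) l) = tmul (tmul h l) k := by
  simp [flip23]

lemma flip23_tmul_right (ξ : H ⊗ₕ K) (l : L) :
    flip23 H K L (tmul ξ l) = tmap (ketRight H l) (.id ℂ K) ξ :=
  DFunLike.congr_fun (f := flip23 H K L ∘L ketRight (H ⊗ₕ K) l)
    (g := tmap (ketRight H l) (.id ℂ K)) (clm_ext fun k l => by simp) ξ

@[simp] lemma leg12_tmul (T : H ⊗ₕ K →L[ℂ] H ⊗ₕ K) (ξ : H ⊗ₕ K) (l : L) :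
    leg12 L T (tmul ξ l) = tmul (T ξ) l := by
  simp [leg12]

@[simp] lemma leg23_tmul (T : K ⊗ₕ L →L[ℂ] K ⊗ₕ L) (h : H) (k : K) (l : L) :
    leg23 H T (tmul (tmul h k) l) = tmap (ketLeft K h) (.id ℂ L) (T (tmul k l)) := by
  simp [leg23, assoc_symm_tmul_left]

@[simp] lemma leg13_tmul (T : H ⊗ₕ L →L[ℂ] H ⊗ₕ L) (h : H) (k : K) (l : L) :
    leg13 K T (tmul (tmul h k) l) = tmap (ketRight H k) (.id ℂ L) (T (tmul h l)) := by
  simp [leg13, flip23_tmul_right]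

lemma leg23_comp_tmap_ketLeft (T : K ⊗ₕ L →L[ℂ] K ⊗ₕ L) (h : H) :
    leg23 H T ∘L tmap (ketLeft K h) (.id ℂ L) = tmap (ketLeft K h) (.id ℂ L) ∘L T :=
  clm_ext fun k l => by simp

lemma leg13_comp_tmap_ketRight (T : H ⊗ₕ L →L[ℂ] H ⊗ₕ L) (k : K) :
    leg13 K T ∘L tmap (ketRight H k) (.id ℂ L) = tmap (ketRight H k) (.id ℂ L) ∘L T :=
  clm_ext fun k l => by simp

lemma leg23_apply_tmap_ketLeft (T : K ⊗ₕ L →L[ℂ] K ⊗ₕ L) (h : H) (ξ : K ⊗ₕ L) :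
    leg23 H T (tmap (ketLeft K h) (.id ℂ L) ξ) = tmap (ketLeft K h) (.id ℂ L) (T ξ) :=
  DFunLike.congr_fun (leg23_comp_tmap_ketLeft T h) ξ

lemma leg13_apply_tmap_ketRight (T : H ⊗ₕ L →L[ℂ] H ⊗ₕ L) (k : K) (ξ : H ⊗ₕ L) :
    leg13 K T (tmap (ketRight H k) (.id ℂ L) ξ) = tmap (ketRight H k) (.id ℂ L) (T ξ) :=
  DFunLike.congr_fun (leg13_comp_tmap_ketRight T k) ξ

lemma leg12_mul (S T : H ⊗ₕ K →L[ℂ] H ⊗ₕ K) : leg12 L (S * T) = leg12 L S * leg12 L T :=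
  clm_ext fun _ _ => by simp

lemma leg23_mul (S T : K ⊗ₕ L →L[ℂ] K ⊗ₕ L) : leg23 H (S * T) = leg23 H S * leg23 H T :=
  clm_ext₃ fun _ _ _ => by simp [leg23_apply_tmap_ketLeft]

lemma leg13_mul (S T : H ⊗ₕ L →L[ℂ] H ⊗ₕ L) : leg13 K (S * T) = leg13 K S * leg13 K T :=
  clm_ext₃ fun _ _ _ => by simp [leg13_apply_tmap_ketRight]

@[simp] lemma leg12_one : leg12 L (1 : H ⊗ₕ K →L[ℂ] H ⊗ₕ K) = 1 := tmap_id

@[simp] lemma leg23_one : leg23 H (1 : K ⊗ₕ L →L[ℂ] K ⊗ₕ L) = 1 :=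
  clm_ext₃ fun _ _ _ => by simp

@[simp] lemma leg13_one : leg13 K (1 : H ⊗ₕ L →L[ℂ] H ⊗ₕ L) = 1 :=
  clm_ext₃ fun _ _ _ => by simp

lemma leg12_adjoint [CompleteSpace L] (T : H ⊗ₕ K →L[ℂ] H ⊗ₕ K) :
    (leg12 L T).adjoint = leg12 L T.adjoint := by
  rw [leg12, tmap_adjoint, adjoint_id, leg12]

lemma adjoint_conj_isometryEquiv {E F : Type*} [NormedAddCommGroup E] [InnerProductSpace ℂ E]
    [CompleteSpace E] [NormedAddCommGroup F] [InnerProductSpace ℂ F] [CompleteSpace F]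
    (e : E ≃ₗᵢ[ℂ] F) (T : F →L[ℂ] F) :
    ((e.symm : F →L[ℂ] E) ∘L T ∘L (e : E →L[ℂ] F)).adjoint =
      (e.symm : F →L[ℂ] E) ∘L T.adjoint ∘L (e : E →L[ℂ] F) := by
  refine ((ContinuousLinearMap.eq_adjoint_iff _ _).2 fun x y => ?_).symm
  change ⟪e.symm (T.adjoint (e x)), y⟫_ℂ = ⟪x, e.symm (T (e y))⟫_ℂ
  rw [← e.inner_map_map, e.apply_symm_apply, adjoint_inner_left, ← e.inner_map_map x,
    e.apply_symm_apply]

lemma leg23_adjoint [CompleteSpace H] (T : K ⊗ₕ L →L[ℂ] K ⊗ₕ L) :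
    (leg23 H T).adjoint = leg23 H T.adjoint := by
  rw [leg23, adjoint_conj_isometryEquiv, tmap_adjoint, adjoint_id, leg23]

/-- The flip interchanges the first two legs. -/
lemma leg12_flip_mul_leg13 (T : H ⊗ₕ L →L[ℂ] H ⊗ₕ L) :
    leg12 L (flip H H : H ⊗ₕ H →L[ℂ] H ⊗ₕ H) * leg13 H T =
      leg23 H T * leg12 L (flip H H : H ⊗ₕ H →L[ℂ] H ⊗ₕ H) := by
  have key : ∀ (k : H) (ξ : H ⊗ₕ L), leg12 L (flip H H : H ⊗ₕ H →L[ℂ] H ⊗ₕ H)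
      (tmap (ketRight H k) (.id ℂ L) ξ) = tmap (ketLeft H k) (.id ℂ L) ξ := fun k ξ =>
    DFunLike.congr_fun (f := leg12 L (flip H H : H ⊗ₕ H →L[ℂ] H ⊗ₕ H) ∘L
      tmap (ketRight H k) (.id ℂ L)) (g := tmap (ketLeft H k) (.id ℂ L))
      (clm_ext fun k l => by simp) ξ
  exact clm_ext₃ fun h k l => by simp [key]

lemma leg12_flip_mul_self :
    leg12 L (flip H H : H ⊗ₕ H →L[ℂ] H ⊗ₕ H) * leg12 L (flip H H : H ⊗ₕ H →L[ℂ] H ⊗ₕ H) = 1 :=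
  clm_ext₃ fun h k l => by simp

end Calculus

end HilbertQG

end

noncomputable section

namespace HilbertQG

open ContinuousLinearMap

/-! ### The equations between natural right absorbers -/

namespace NaturalRightAbsorber

variable {C : HilbertTensorCategory.{u, v}} {H : Type u}
  [NormedAddCommGroup H] [InnerProductSpace ℂ H] [CompleteSpace H] {ρ : C.Obj H}

/-- Naturality along ℂ ⊗ ℂ → ℂ together with the tensor rule gives u = u², and the only idempotent
unitary is 1. -/
lemma U_triv_unit (A : NaturalRightAbsorber C ρ) : A.U (C.triv CUnit.{u}) = 1 := by
  set u := A.U (C.triv CUnit.{u}) with hu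
  set e : CUnit.{u} := ⟨1⟩
  -- On the one-dimensional unit both ket maps agree, so a single insertion of `e` strips leg 23 and
  -- then leg 13.
  have hket : ketLeft CUnit.{u} e = ketRight CUnit.{u} e := by
    ext c
    have hc : c = c.down • e := by ext; simp [e]
    rw [ketLeft_apply, ketRight_apply, hc, smul_tmul, tmul_smul]
  have hunit : (leftUnitor.{u} CUnit.{u}).toContinuousLinearMap ∘L ketLeft CUnit.{u} e =
      .id ℂ CUnit.{u} := by
    ext c
    simp [leftUnitor, e]
  have hnat := A.natural (C.leftUnitor_mem (C.triv CUnit.{u}))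
  rw [A.tensor_eq, ← hu] at hnat
  have h1 := congrArg (· ∘L tmap (ketLeft CUnit.{u} e) (.id ℂ H)) hnat
  simp only [comp_assoc] at h1
  rw [leg23_comp_tmap_ketLeft, hket, ← comp_assoc (leg13 _ _), leg13_comp_tmap_ketRight, ← hket,
    comp_assoc, ← comp_assoc (tmap (leftUnitor _).toContinuousLinearMap _), tmap_comp, hunit,
    ContinuousLinearMap.id_comp, tmap_id, ContinuousLinearMap.id_comp,
    ContinuousLinearMap.comp_id] at h1
  have h2 : u * 1 = u * u := by rw [mul_one]; exact h1
  have hU := (Unitary.mem_iff.1 (A.unitary_mem (C.triv CUnit.{u}))).1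
  rw [← hu] at hU
  calc u = star u * u * u := by rw [hU, one_mul]
    _ = 1 := by rw [mul_assoc, ← h2, mul_one, hU]

/-- Each vector k is the image of 1 under the arrow c ↦ c k from τ(ℂ) to τ(K), so naturality reduces
the claim to the unit. -/
lemma U_triv (A : NaturalRightAbsorber C ρ) (K : Type u) [NormedAddCommGroup K]
    [InnerProductSpace ℂ K] [CompleteSpace K] : A.U (C.triv K) = 1 := by
  refine clm_ext fun k h => ?_
  set a : CUnit.{u} →L[ℂ] K :=
    (ContinuousLinearMap.toSpanSingleton ℂ k) ∘L
      (ContinuousLinearEquiv.ulift : CUnit.{u} ≃L[ℂ] ℂ).toContinuousLinearMap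
  have ha : a ⟨1⟩ = k := one_smul ℂ k
  have h1 := DFunLike.congr_fun (A.natural (C.triv_hom a)) (tmul ⟨1⟩ h)
  rw [U_triv_unit] at h1
  simpa [ha] using h1

/-- The relation between two natural right absorbers evaluated at an object. -/
lemma leg23_mul_leg12 (A : NaturalRightAbsorber C ρ) {L : Type u} [NormedAddCommGroup L]
    [InnerProductSpace ℂ L] [CompleteSpace L] {σ : C.Obj L} (B : NaturalRightAbsorber C σ)
    {K : Type u} [NormedAddCommGroup K] [InnerProductSpace ℂ K] [CompleteSpace K] (x : C.Obj K) :
    leg23 K (B.U ρ) * leg12 L (A.U x) = leg12 L (A.U x) * leg13 H (B.U x) * leg23 K (B.U ρ) := by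
  -- On the target τ(x) ⊗ ρ the factor in legs 13 is 1 by `U_triv`; on the source x ⊗ ρ it survives
  -- as `B.U x`.
  have h := B.natural (A.hom_mem x)
  rw [B.tensor_eq, B.tensor_eq, U_triv, leg13_one] at h
  exact h

lemma isMultiplicativeUnitary (A : NaturalRightAbsorber C ρ) : IsMultiplicativeUnitary (A.U ρ) :=
  ⟨A.unitary_mem ρ, A.leg23_mul_leg12 A ρ⟩

end NaturalRightAbsorber

/-! ### Consequences of manageability -/

section ConjSpace

@[simp] lemma ofConj_toConj {H : Type*} (x : H) : ofConj (toConj x) = x := rfl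

@[simp] lemma toConj_ofConj {H : Type*} (x : ConjSpace H) : toConj (ofConj x) = x := rfl

variable {H : Type*} [NormedAddCommGroup H]

lemma toConj_add (x y : H) : toConj (x + y) = toConj x + toConj y := rfl

lemma ofConj_add (x y : ConjSpace H) : ofConj (x + y) = ofConj x + ofConj y := rfl

lemma continuous_toConj : Continuous (toConj : H → ConjSpace H) := continuous_id

lemma continuous_ofConj : Continuous (ofConj : ConjSpace H → H) := continuous_id

end ConjSpace

/-! ### The antiunitary flip, self-adjoint operators and manageability -/

section Managing

variable {H : Type*} [NormedAddCommGroup H] [InnerProductSpace ℂ H]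

instance [CompleteSpace H] : CompleteSpace (ConjSpace H) := inferInstanceAs (CompleteSpace H)

lemma inner_toConj (x y : H) : ⟪toConj x, toConj y⟫_ℂ = ⟪y, x⟫_ℂ := rfl

lemma toConj_smul (c : ℂ) (x : H) : toConj (c • x) = starRingEnd ℂ c • toConj x := by
  change c • x = starRingEnd ℂ (starRingEnd ℂ c) • x
  rw [Complex.conj_conj]

lemma smul_toConj (c : ℂ) (x : H) : c • toConj x = toConj (starRingEnd ℂ c • x) := rfl

lemma ofConj_smul (c : ℂ) (x : ConjSpace H) : ofConj (c • x) = starRingEnd ℂ c • ofConj x := rfl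

variable (H) in
/-- The linear isometry underlying `conjFlip`. -/
def conjFlipAux : ConjSpace H ⊗ₕ H →ₗᵢ[ℂ] ConjSpace (ConjSpace H ⊗ₕ H) :=
  liftIsometry (LinearMap.mk₂ ℂ (fun a b => toConj (tmul (toConj b) (ofConj a)))
    (fun a a' b => by rw [ofConj_add, tmul_add, toConj_add])
    (fun c a b => by rw [ofConj_smul, tmul_smul, smul_toConj])
    (fun a b b' => by rw [toConj_add, add_tmul, toConj_add])
    (fun c a b => by rw [toConj_smul, smul_tmul, smul_toConj]))
    (fun a a' b b' => by
      simp only [LinearMap.mk₂_apply, inner_toConj, inner_tmul]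
      rw [mul_comm]; rfl)

/-- The antiunitary operator `x̄ ⊗ y ↦ ȳ ⊗ x` on `H̄ ⊗ H`. -/
def conjFlip (ξ : ConjSpace H ⊗ₕ H) : ConjSpace H ⊗ₕ H := ofConj (conjFlipAux H ξ)

@[simp] lemma conjFlip_tmul (a : ConjSpace H) (b : H) :
    conjFlip (tmul a b) = tmul (toConj b) (ofConj a) := by
  simp [conjFlip, conjFlipAux]

lemma conjFlip_add (ξ η : ConjSpace H ⊗ₕ H) : conjFlip (ξ + η) = conjFlip ξ + conjFlip η := by
  simp [conjFlip, ofConj_add]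

lemma conjFlip_zero : conjFlip (0 : ConjSpace H ⊗ₕ H) = 0 := by
  simp only [conjFlip, map_zero]; rfl

lemma conjFlip_smul (c : ℂ) (ξ : ConjSpace H ⊗ₕ H) :
    conjFlip (c • ξ) = starRingEnd ℂ c • conjFlip ξ := by
  simp [conjFlip, ofConj_smul]

lemma norm_conjFlip (ξ : ConjSpace H ⊗ₕ H) : ‖conjFlip ξ‖ = ‖ξ‖ :=
  (conjFlipAux H).norm_map ξ

lemma continuous_conjFlip : Continuous (conjFlip : ConjSpace H ⊗ₕ H → ConjSpace H ⊗ₕ H) :=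
  continuous_ofConj.comp (conjFlipAux H).continuous

lemma inner_conjFlip (ξ η : ConjSpace H ⊗ₕ H) : ⟪conjFlip ξ, conjFlip η⟫_ℂ = ⟪η, ξ⟫_ℂ :=
  (conjFlipAux H).inner_map_map η ξ

@[simp] lemma conjFlip_conjFlip (ξ : ConjSpace H ⊗ₕ H) : conjFlip (conjFlip ξ) = ξ := by
  induction ξ using htensor_induction with
  | hp => exact isClosed_eq (continuous_conjFlip.comp continuous_conjFlip) continuous_id
  | h0 => simp [conjFlip_zero]
  | ht a b => simp
  | ha x y hx hy => rw [conjFlip_add, conjFlip_add, hx, hy]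

/-- The operator `ξ ↦ J T J ξ` for the antiunitary `J = conjFlip`. -/
def conjFlipConj (T : ConjSpace H ⊗ₕ H →L[ℂ] ConjSpace H ⊗ₕ H) :
    ConjSpace H ⊗ₕ H →L[ℂ] ConjSpace H ⊗ₕ H :=
  LinearMap.mkContinuous
    { toFun := fun ξ => conjFlip (T (conjFlip ξ))
      map_add' := fun ξ η => by simp only [conjFlip_add, map_add]
      map_smul' := fun c ξ => by simp [conjFlip_smul] }
    ‖T‖ fun ξ => by
      change ‖conjFlip (T (conjFlip ξ))‖ ≤ _
      rw [norm_conjFlip]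
      exact (T.le_opNorm _).trans_eq (by rw [norm_conjFlip])

lemma conjFlipConj_apply (T : ConjSpace H ⊗ₕ H →L[ℂ] ConjSpace H ⊗ₕ H) (ξ : ConjSpace H ⊗ₕ H) :
    conjFlipConj T ξ = conjFlip (T (conjFlip ξ)) := rfl

/-- The legs of `ξ` and of the flip of `conjFlip ξ` in `H ⊗ H̄`. -/
lemma ketLeft_adjoint_flip_conjFlip [CompleteSpace H] (e : H) (ξ : ConjSpace H ⊗ₕ H) :
    (ketLeft (ConjSpace H) e).adjoint (flip (ConjSpace H) H (conjFlip ξ)) =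
      toConj ((ketLeft H (toConj e)).adjoint ξ) := by
  induction ξ using htensor_induction with
  | hp =>
    exact isClosed_eq (by have := continuous_conjFlip (H := H); fun_prop)
      (continuous_toConj.comp (ContinuousLinearMap.continuous _))
  | h0 => simp only [conjFlip_zero, map_zero]; rfl
  | ht a b =>
    simp only [conjFlip_tmul, flip_tmul, ketLeft_adjoint_tmul, toConj_smul]
    congr 1
    exact (inner_conj_symm (𝕜 := ℂ) e (ofConj a)).symm
  | ha x y hx hy => simp only [conjFlip_add, map_add, hx, hy, toConj_add]

lemma inner_flip (ξ η : H ⊗ₕ H) : ⟪ξ, flip H H η⟫_ℂ = ⟪flip H H ξ, η⟫_ℂ := by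
  have h : flip H H (flip H H η) = η := (flip H H).symm_apply_apply η
  rw [← (flip H H).inner_map_map, h]

variable [CompleteSpace H]

section SelfAdjoint

variable {Q : H →ₗ.[ℂ] H}

lemma inner_apply_eq_of_isSelfAdjoint (hQ : IsSelfAdjoint Q) (u v : Q.domain) :
    ⟪Q u, (v : H)⟫_ℂ = ⟪(u : H), Q v⟫_ℂ := by
  have h := LinearPMap.adjoint_isFormalAdjoint hQ.dense_domain
  rw [LinearPMap.isSelfAdjoint_def.1 hQ] at h
  exact h u v

/-- The hypothesis is the criterion for s ∈ dom Q* with Q* s = t, and Q* = Q. This is the device for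
proving that a vector lies in dom Q. -/
lemma exists_apply_eq_of_isSelfAdjoint (hQ : IsSelfAdjoint Q) {s t : H}
    (h : ∀ u : Q.domain, ⟪t, (u : H)⟫_ℂ = ⟪s, Q u⟫_ℂ) : ∃ u : Q.domain, (u : H) = s ∧ Q u = t := by
  have hs : s ∈ Q.adjoint.domain := LinearPMap.mem_adjoint_domain_of_exists s ⟨t, h⟩
  have ht : Q.adjoint ⟨s, hs⟩ = t := LinearPMap.adjoint_apply_eq hQ.dense_domain ⟨s, hs⟩ h
  have hQ' := LinearPMap.isSelfAdjoint_def.1 hQ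
  revert hs ht
  rw [hQ']
  exact fun hs ht => ⟨⟨s, hs⟩, rfl, ht⟩

/-- A vector orthogonal to the range lies in ker Q* = ker Q = 0. -/
lemma dense_range_of_isSelfAdjoint (hQ : IsSelfAdjoint Q)
    (hker : ∀ u : Q.domain, Q u = 0 → u = 0) : DenseRange (Q : Q.domain → H) := by
  have h : Dense ((LinearMap.range Q.toFun : Submodule ℂ H) : Set H) := by
    rw [Submodule.dense_iff_topologicalClosure_eq_top, Submodule.topologicalClosure_eq_top_iff,
      Submodule.eq_bot_iff]
    intro s hs
    rw [Submodule.mem_orthogonal'] at hs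
    obtain ⟨u, rfl, hu⟩ := exists_apply_eq_of_isSelfAdjoint hQ (s := s) (t := 0) fun u => by
      rw [inner_zero_left]; exact (hs _ ⟨u, rfl⟩).symm
    rw [hker u hu]; rfl
  exact h

end SelfAdjoint

/-- The properties of a manageable unitary `W`, with `Q` and `W̃`, that make its slices a
`C*`-algebra. They are invariant under passing to the dual. -/
structure IsManaged (W : H ⊗ₕ H →L[ℂ] H ⊗ₕ H) (Q : H →ₗ.[ℂ] H)
    (W' : ConjSpace H ⊗ₕ H →L[ℂ] ConjSpace H ⊗ₕ H) : Prop where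
  isSelfAdjoint : IsSelfAdjoint Q
  ker_eq : ∀ u : Q.domain, Q u = 0 → u = 0
  surjective : Function.Surjective W'
  inner_snd : ∀ (x z : H) (u v : Q.domain), ⟪tmul x (u : H), W (tmul z (Q v))⟫_ℂ =
    ⟪tmul (toConj z) (Q u), W' (tmul (toConj x) (v : H))⟫_ℂ
  inner_fst : ∀ (x z : Q.domain) (u v : H), ⟪tmul (Q x) u, W (tmul (z : H) v)⟫_ℂ =
    ⟪tmul (toConj (Q z)) u, W' (tmul (toConj (x : H)) v)⟫_ℂ

/-- The condition on `p` is closed and linear, so the symmetry of Q on the generators of the graph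
suffices. -/
lemma inner_tensorSquareGraph {Q : H →ₗ.[ℂ] H} (hQ : IsSelfAdjoint Q) (x u : Q.domain)
    {p : (H ⊗ₕ H) × (H ⊗ₕ H)} (hp : p ∈ tensorSquareGraph Q) :
    ⟪tmul (Q x) (Q u), p.1⟫_ℂ = ⟪tmul (x : H) (u : H), p.2⟫_ℂ := by
  let f : (H ⊗ₕ H) × (H ⊗ₕ H) →L[ℂ] ℂ :=
    innerSL ℂ (tmul (Q x) (Q u)) ∘L ContinuousLinearMap.fst ℂ _ _ -
      innerSL ℂ (tmul (x : H) (u : H)) ∘L ContinuousLinearMap.snd ℂ _ _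
  have h : f p ∈ (⊥ : Submodule ℂ ℂ) := by
    refine map_mem_of_closedSpan f isClosed_singleton ?_ hp
    rintro _ ⟨q, rfl⟩
    simp [f, inner_apply_eq_of_isSelfAdjoint hQ]
  exact sub_eq_zero.1 h

/-- The invariance of Q ⊗ Q under W moves Q from the second legs to the first, which turns
`inner_snd` into `inner_fst`; there the second-leg vectors are arbitrary, by density of the range
and domain of Q. -/
lemma IsManageable.exists_isManaged {W : H ⊗ₕ H →L[ℂ] H ⊗ₕ H} (hW : IsManageable W) :
    ∃ Q W', IsManaged W Q W' := by
  obtain ⟨Q, W', hQ, -, hker, hW', hgraph, hinner⟩ := hW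
  refine ⟨Q, W', hQ, hker, fun ξ => ⟨star W' ξ, ?_⟩, hinner, fun x z u v => ?_⟩
  · exact DFunLike.congr_fun (Unitary.mem_iff.1 hW').2 ξ
  · have hd := dense_range_of_isSelfAdjoint hQ hker
    refine hd.induction (P := fun u => ⟪tmul (Q x) u, W (tmul (z : H) v)⟫_ℂ =
      ⟪tmul (toConj (Q z)) u, W' (tmul (toConj (x : H)) v)⟫_ℂ) ?_ (isClosed_eq
        ((ketLeft H (Q x)).continuous.inner continuous_const)
        ((ketLeft H (toConj (Q z))).continuous.inner continuous_const)) u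
    rintro _ ⟨u, rfl⟩
    refine hQ.dense_domain.induction (P := fun v => ⟪tmul (Q x) (Q u), W (tmul (z : H) v)⟫_ℂ =
      ⟪tmul (toConj (Q z)) (Q u), W' (tmul (toConj (x : H)) v)⟫_ℂ) ?_ (isClosed_eq
        (continuous_const.inner (W ∘L ketLeft H (z : H)).continuous)
        (continuous_const.inner (W' ∘L ketLeft H (toConj (x : H))).continuous)) v
    intro v hv
    -- As W preserves the graph, ⟪Qx ⊗ Qu, W(z ⊗ v)⟫ = ⟪x ⊗ u, W(Qz ⊗ Qv)⟫, to which the defining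
    -- identity applies.
    have hmem : (tmul (z : H) v, tmul (Q z) (Q ⟨v, hv⟩)) ∈ tensorSquareGraph Q :=
      subset_closedSpan ⟨(z, ⟨v, hv⟩), rfl⟩
    have h := inner_tensorSquareGraph hQ x u ((hgraph _ _).2 hmem)
    dsimp only at h
    rw [h, hinner]

/-- The dual `Σ W* Σ` of a multiplicative unitary. -/
def dualUnitary (W : H ⊗ₕ H →L[ℂ] H ⊗ₕ H) : H ⊗ₕ H →L[ℂ] H ⊗ₕ H :=
  (flip H H : H ⊗ₕ H →L[ℂ] H ⊗ₕ H) ∘L W.adjoint ∘L (flip H H : H ⊗ₕ H →L[ℂ] H ⊗ₕ H)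

lemma inner_dualUnitary (W : H ⊗ₕ H →L[ℂ] H ⊗ₕ H) (x u z y : H) :
    ⟪tmul x u, dualUnitary W (tmul z y)⟫_ℂ = starRingEnd ℂ ⟪tmul y z, W (tmul u x)⟫_ℂ := by
  rw [inner_conj_symm]
  change ⟪_, flip H H (W.adjoint (flip H H _))⟫_ℂ = _
  rw [inner_flip, flip_tmul, flip_tmul, adjoint_inner_right]

/-- Matrix coefficients of ΣW*Σ are conjugates of those of W with the legs exchanged. The
antiunitary `conjFlip` does the same on H̄ ⊗ H, so the two inner product identities trade places
while Q stays. -/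
lemma IsManaged.dual {W : H ⊗ₕ H →L[ℂ] H ⊗ₕ H} {Q : H →ₗ.[ℂ] H}
    {W' : ConjSpace H ⊗ₕ H →L[ℂ] ConjSpace H ⊗ₕ H} (h : IsManaged W Q W') :
    IsManaged (dualUnitary W) Q (conjFlipConj W') where
  isSelfAdjoint := h.isSelfAdjoint
  ker_eq := h.ker_eq
  surjective := fun ξ => by
    obtain ⟨η, hη⟩ := h.surjective (conjFlip ξ)
    exact ⟨conjFlip η, by rw [conjFlipConj_apply, conjFlip_conjFlip, hη, conjFlip_conjFlip]⟩
  inner_snd := fun x z u v => by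
    rw [inner_dualUnitary, h.inner_fst, inner_conj_symm, conjFlipConj_apply, conjFlip_tmul,
      ← inner_conjFlip, conjFlip_tmul]
    rfl
  inner_fst := fun x z u v => by
    rw [inner_dualUnitary, h.inner_snd, inner_conj_symm, conjFlipConj_apply, conjFlip_tmul,
      ← inner_conjFlip, conjFlip_tmul]
    rfl

end Managing

end HilbertQG

end

noncomputable section

namespace HilbertQG

open ContinuousLinearMap

/-! ### The column module of the algebra of a multiplicative unitary -/

section Column

variable {H K L F : Type*} [NormedAddCommGroup H] [InnerProductSpace ℂ H] [CompleteSpace H]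
  [NormedAddCommGroup K] [InnerProductSpace ℂ K] [CompleteSpace K]
  [NormedAddCommGroup L] [InnerProductSpace ℂ L] [CompleteSpace L]
  [NormedAddCommGroup F] [NormedSpace ℂ F]

/-- The slice `(⟨x| ⊗ 1) W (|z⟩ ⊗ 1)`. -/
def leftSlice (W : H ⊗ₕ K →L[ℂ] H ⊗ₕ K) (x z : H) : K →L[ℂ] K :=
  (ketLeft K x).adjoint ∘L W ∘L ketLeft K z

lemma continuous_ketLeft : Continuous (ketLeft K : H → (K →L[ℂ] H ⊗ₕ K)) :=
  (ketLeftL H K).continuous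

lemma continuous_adjoint : Continuous fun T : H →L[ℂ] K => T.adjoint :=
  (ContinuousLinearMap.adjoint (𝕜 := ℂ) (E := H) (F := K)).continuous

lemma continuous_leftSlice_fst (W : H ⊗ₕ K →L[ℂ] H ⊗ₕ K) (z : H) :
    Continuous fun x => leftSlice W x z :=
  (continuous_adjoint.comp continuous_ketLeft).clm_comp continuous_const

lemma continuous_leftSlice_snd (W : H ⊗ₕ K →L[ℂ] H ⊗ₕ K) (x : H) :
    Continuous fun z => leftSlice W x z :=
  continuous_const.clm_comp (continuous_const.clm_comp continuous_ketLeft)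

lemma leftSlice_adjoint (W : H ⊗ₕ K →L[ℂ] H ⊗ₕ K) (x z : H) :
    (leftSlice W x z).adjoint = leftSlice W.adjoint z x := by
  simp only [leftSlice, adjoint_comp, adjoint_adjoint, comp_assoc]

lemma leftSlice_mem (W : H ⊗ₕ H →L[ℂ] H ⊗ₕ H) (x z : H) :
    leftSlice W x z ∈ quantumAlgebra W :=
  subset_closedSpan ⟨(x, z), rfl⟩

lemma isClosed_quantumAlgebra (W : H ⊗ₕ H →L[ℂ] H ⊗ₕ H) :
    IsClosed (quantumAlgebra W : Set (H →L[ℂ] H)) :=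
  Submodule.isClosed_topologicalClosure _

/-- To map the slices of `W` into a closed subspace is to map its algebra there. -/
lemma map_mem_of_leftSlice {σ : ℂ →+* ℂ} {W : H ⊗ₕ H →L[ℂ] H ⊗ₕ H}
    (f : (H →L[ℂ] H) →SL[σ] F) {N : Submodule ℂ F} (hN : IsClosed (N : Set F))
    (h : ∀ x z, f (leftSlice W x z) ∈ N) {a : H →L[ℂ] H} (ha : a ∈ quantumAlgebra W) :
    f a ∈ N :=
  map_mem_of_closedSpan f hN (by rintro _ ⟨p, rfl⟩; exact h p.1 p.2) ha

/-- The closed linear span of the operators `|k⟩ ⊗ a` for `k ∈ K`, `a ∈ A`. -/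
def columnModule (K : Type*) [NormedAddCommGroup K] [InnerProductSpace ℂ K]
    (A : Submodule ℂ (H →L[ℂ] H)) : Submodule ℂ (H →L[ℂ] K ⊗ₕ H) :=
  (Submodule.span ℂ (Set.range fun p : K × A =>
    ketLeft H p.1 ∘L (p.2 : H →L[ℂ] H))).topologicalClosure

variable {A : Submodule ℂ (H →L[ℂ] H)}

lemma isClosed_columnModule : IsClosed (columnModule K A : Set (H →L[ℂ] K ⊗ₕ H)) :=
  Submodule.isClosed_topologicalClosure _

lemma ketLeft_comp_mem_columnModule (k : K) {a : H →L[ℂ] H} (ha : a ∈ A) :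
    ketLeft H k ∘L a ∈ columnModule K A :=
  subset_closedSpan ⟨(k, ⟨a, ha⟩), rfl⟩

lemma map_mem_of_columnModule (f : (H →L[ℂ] K ⊗ₕ H) →L[ℂ] F) {N : Submodule ℂ F}
    (hN : IsClosed (N : Set F)) (h : ∀ k, ∀ a ∈ A, f (ketLeft H k ∘L a) ∈ N)
    {T : H →L[ℂ] K ⊗ₕ H} (hT : T ∈ columnModule K A) : f T ∈ N :=
  map_mem_of_closedSpan f hN (by rintro _ ⟨p, rfl⟩; exact h p.1 _ p.2.2) hT

/-! ### Slices of the pentagon equation -/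

lemma tmap_ketRight_adjoint_ketLeft (x : H) (k : K) (ξ : H ⊗ₕ L) :
    tmap ((ketRight K x).adjoint ∘L ketLeft H k) (.id ℂ L) ξ =
      tmul k ((ketLeft L x).adjoint ξ) :=
  DFunLike.congr_fun (f := tmap ((ketRight K x).adjoint ∘L ketLeft H k) (.id ℂ L))
    (g := ketLeft L k ∘L (ketLeft L x).adjoint)
    (clm_ext fun h l => by simp [smul_tmul]) ξ

/-- V₁₃ does not touch the middle leg, so a bra there passes through it. -/
lemma slice_leg13 (V : K ⊗ₕ L →L[ℂ] K ⊗ₕ L) (x : H) :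
    tmap (ketRight K x).adjoint (.id ℂ L) ∘L leg13 H V =
      V ∘L tmap (ketRight K x).adjoint (.id ℂ L) := by
  refine clm_ext₃ fun k h l => ?_
  have h1 : tmap (⟪x, h⟫_ℂ • .id ℂ K) (.id ℂ L) = ⟪x, h⟫_ℂ • .id ℂ (K ⊗ₕ L) :=
    clm_ext fun k l => by simp [smul_tmul]
  simp [tmap_tmap, ketRight_adjoint_comp_ketRight, smul_tmul, h1]

lemma slice_leg23_ketLeft (W : H ⊗ₕ L →L[ℂ] H ⊗ₕ L) (x z : H) (k : K) :
    tmap (ketRight K x).adjoint (.id ℂ L) ∘L leg23 K W ∘L ketLeft L (tmul k z) =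
      ketLeft L k ∘L leftSlice W x z := by
  ext y
  simp [tmap_tmap, tmap_ketRight_adjoint_ketLeft, leftSlice]

lemma slice_leg12_leg23_ketLeft (T : K ⊗ₕ H →L[ℂ] K ⊗ₕ H) (W : H ⊗ₕ L →L[ℂ] H ⊗ₕ L) (x z : H)
    (k : K) : tmap (ketRight K x).adjoint (.id ℂ L) ∘L leg12 L T ∘L leg23 K W ∘L
      ketLeft L (tmul k z) =
      tmap ((ketRight K x).adjoint ∘L T ∘L ketLeft H k) (.id ℂ L) ∘L W ∘L ketLeft L z := by
  ext y
  simp [leg12, tmap_tmap]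

/-- For a unitary `V` adapted to `W`, the operators `V (|k⟩ ⊗ (ω ⊗ id) W)` and the operators
`(T ⊗ 1) W (|z⟩ ⊗ 1)`, where `T` is a slice of `Σ V*`, have the same closed span. -/
lemma map_slice_mem_iff {V : K ⊗ₕ H →L[ℂ] K ⊗ₕ H} {W : H ⊗ₕ H →L[ℂ] H ⊗ₕ H}
    (hV : V ∈ unitary (K ⊗ₕ H →L[ℂ] K ⊗ₕ H))
    (hVW : leg23 K W * leg12 H V = leg12 H V * leg13 H V * leg23 K W)
    (G : (H →L[ℂ] K ⊗ₕ H) →L[ℂ] F) {N : Submodule ℂ F} (hN : IsClosed (N : Set F)) (x : H) :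
    (∀ k z, G (V ∘L ketLeft H k ∘L leftSlice W x z) ∈ N) ↔
      ∀ k z, G (tmap ((ketRight K x).adjoint ∘L V.adjoint ∘L ketLeft H k) (.id ℂ H) ∘L
        W ∘L ketLeft H z) ∈ N := by
  obtain ⟨hV1, hV2⟩ := Unitary.mem_iff.1 hV
  rw [star_eq_adjoint] at hV1 hV2
  -- With the middle leg sliced by ⟨x|, the two sides of this identity become `f` and `g ∘ V`. As V
  -- is a bijection of K ⊗ H, `f` and `g` have the same range.
  have hVW' : leg13 H V * leg23 K W = leg12 H V.adjoint * leg23 K W * leg12 H V := by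
    rw [mul_assoc, hVW, ← mul_assoc, ← mul_assoc, ← leg12_mul, hV1, leg12_one, one_mul]
  let S := tmap (ketRight K x).adjoint (.id ℂ H)
  let f : K ⊗ₕ H →L[ℂ] F := G ∘L compL ℂ H _ _ (S ∘L (leg13 H V * leg23 K W)) ∘L ketLeftL _ H
  let g : K ⊗ₕ H →L[ℂ] F :=
    G ∘L compL ℂ H _ _ (S ∘L (leg12 H V.adjoint * leg23 K W)) ∘L ketLeftL _ H
  have hfg : ∀ ζ, f ζ = g (V ζ) := fun ζ => by
    have : leg12 H V ∘L ketLeft H ζ = ketLeft H (V ζ) := by ext; simp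
    simp only [f, g, hVW', comp_apply, compL_apply, ketLeftL_apply, ← this]
    rfl
  have hf : ∀ k z, f (tmul k z) = G (V ∘L ketLeft H k ∘L leftSlice W x z) := fun k z => by
    rw [← slice_leg23_ketLeft, ← comp_assoc, ← slice_leg13]
    rfl
  have hg : ∀ k z, g (tmul k z) = G (tmap ((ketRight K x).adjoint ∘L V.adjoint ∘L ketLeft H k)
      (.id ℂ H) ∘L W ∘L ketLeft H z) := fun k z => by
    rw [← slice_leg12_leg23_ketLeft]
    rfl
  simp only [← hf, ← hg]
  constructor
  · intro h k z
    have h1 := map_mem_of_tmul f hN h (V.adjoint (tmul k z))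
    have h2 : V (V.adjoint (tmul k z)) = tmul k z := DFunLike.congr_fun hV2 _
    rwa [hfg, h2] at h1
  · intro h k z
    rw [hfg]
    exact map_mem_of_tmul g hN h _

end Column

/-! ### The algebra of a managed multiplicative unitary -/

section Managed

variable {H : Type*} [NormedAddCommGroup H] [InnerProductSpace ℂ H] [CompleteSpace H]
  {W : H ⊗ₕ H →L[ℂ] H ⊗ₕ H} {Q : H →ₗ.[ℂ] H} {W' : ConjSpace H ⊗ₕ H →L[ℂ] ConjSpace H ⊗ₕ H}

/-- The operator `(1 ⊗ ⟨q̄| ⊗ 1) W'₂₃ (|s⟩ ⊗ 1)` for `s ∈ H ⊗ H̄`. -/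
def conjSlice (W' : ConjSpace H ⊗ₕ H →L[ℂ] ConjSpace H ⊗ₕ H) (q : ConjSpace H) :
    H ⊗ₕ ConjSpace H →L[ℂ] (H →L[ℂ] H ⊗ₕ H) :=
  compL ℂ H _ _ (tmap (.id ℂ H) ((ketLeft H q).adjoint ∘L W') ∘L
    (assoc H (ConjSpace H) H : (H ⊗ₕ ConjSpace H) ⊗ₕ H →L[ℂ] H ⊗ₕ (ConjSpace H ⊗ₕ H))) ∘L
    ketLeftL _ H

lemma conjSlice_tmul (q : ConjSpace H) (h : H) (p : ConjSpace H) :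
    conjSlice W' q (tmul h p) = ketLeft H h ∘L leftSlice W' q p := by
  ext y
  simp [conjSlice, leftSlice]

lemma inner_conjSlice (q : ConjSpace H) (s : H ⊗ₕ ConjSpace H) (e f y : H) :
    ⟪tmul e f, conjSlice W' q s y⟫_ℂ =
      ⟪tmul q f, W' (tmul ((ketLeft (ConjSpace H) e).adjoint s) y)⟫_ℂ := by
  have h : (innerSL ℂ (tmul e f)) ∘L (ContinuousLinearMap.apply ℂ (H ⊗ₕ H) y) ∘L conjSlice W' q =
      (innerSL ℂ (tmul q f)) ∘L W' ∘L ketRight _ y ∘L (ketLeft (ConjSpace H) e).adjoint :=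
    clm_ext fun h p => by
      simp [conjSlice_tmul, leftSlice, adjoint_inner_right]
  exact DFunLike.congr_fun h s

/-- Manageability is used twice: `inner_snd` expresses T* through Q and a slice of W̃, and
`inner_fst` then absorbs this Q. The outcome is a vector of H ⊗ H̄ whose second leg feeds the slices
of W̃. -/
lemma IsManaged.tmap_slice_eq (h : IsManaged W Q W') (k : H) (v z : Q.domain) :
    tmap ((ketRight H (Q v)).adjoint ∘L W.adjoint ∘L ketLeft H k) (.id ℂ H) ∘L W ∘L
      ketLeft H (z : H) =
    conjSlice W' (toConj (Q z))
      (flip (ConjSpace H) H (conjFlip (W' (tmul (toConj k) (v : H))))) := by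
  set T := (ketRight H (Q v)).adjoint ∘L W.adjoint ∘L ketLeft H k with hT
  ext y
  refine eq_of_inner_tmul fun e f => ?_
  rw [inner_conjSlice, ketLeft_adjoint_flip_conjFlip]
  -- The slice s of W̃(k̄ ⊗ v) by ē lies in dom Q with Q s = T* e, because `inner_snd` gives ⟪T* e,
  -- u⟫ = ⟪s, Q u⟫ for u ∈ dom Q.
  obtain ⟨s, hs, hQs⟩ := exists_apply_eq_of_isSelfAdjoint h.isSelfAdjoint
    (s := (ketLeft H (toConj e)).adjoint (W' (tmul (toConj k) (v : H)))) (t := T.adjoint e)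
    fun u => by
      rw [adjoint_inner_left, adjoint_inner_left, ketLeft_apply, ← inner_conj_symm (𝕜 := ℂ) (W' _),
        ← h.inner_snd, inner_conj_symm, hT, comp_apply, comp_apply, adjoint_inner_right,
        adjoint_inner_right, ketRight_apply, ketLeft_apply]
  rw [← hs, ← h.inner_fst, hQs, comp_apply, ← adjoint_inner_left, tmap_adjoint, tmap_tmul,
    adjoint_id]
  rfl

lemma IsManaged.leftSlice_eq (h : IsManaged W Q W') (p z : Q.domain) :
    leftSlice W' (toConj (Q z)) (toConj (p : H)) = leftSlice W (Q p) z := by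
  ext y
  refine ext_inner_left ℂ fun u => ?_
  simp only [leftSlice, comp_apply, adjoint_inner_right, ketLeft_apply]
  exact (h.inner_fst p z u y).symm

/-- For p in dom Q the slice of W̃ is one of W by `leftSlice_eq`; the rest is density of dom Q and
closedness of A. -/
lemma IsManaged.leftSlice_mem (h : IsManaged W Q W') (z : Q.domain) (p : ConjSpace H) :
    leftSlice W' (toConj (Q z)) p ∈ quantumAlgebra W := by
  refine map_mem_of_dense (E := ConjSpace H) (S := (Q.domain : Set H)) h.isSelfAdjoint.dense_domain
    (f := fun p => leftSlice W' (toConj (Q z)) p) (continuous_leftSlice_snd W' _)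
    (isClosed_quantumAlgebra W) (fun p hp => ?_) p
  have := h.leftSlice_eq ⟨p, hp⟩ z
  rw [show p = toConj ((⟨p, hp⟩ : Q.domain) : H) from rfl, this]
  exact HilbertQG.leftSlice_mem W _ _

lemma IsManaged.denseRange (h : IsManaged W Q W') : DenseRange (Q : Q.domain → H) :=
  dense_range_of_isSelfAdjoint h.isSelfAdjoint h.ker_eq

/-- By density the bra is Q v. The sliced pentagon replaces W(|k⟩ ⊗ slice) by (T ⊗ 1) W (|z⟩ ⊗ 1),
which `tmap_slice_eq` writes as a limit of sums of |e⟩ ⊗ slices of W̃. -/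
lemma IsManaged.comp_mem_columnModule (h : IsManaged W Q W') (hW : IsMultiplicativeUnitary W)
    {T : H →L[ℂ] H ⊗ₕ H} (hT : T ∈ columnModule H (quantumAlgebra W)) :
    W ∘L T ∈ columnModule H (quantumAlgebra W) := by
  refine map_mem_of_columnModule (compL ℂ H _ _ W) isClosed_columnModule (fun k a ha => ?_) hT
  refine map_mem_of_leftSlice (compL ℂ H _ _ W ∘L compL ℂ H _ _ (ketLeft H k))
    isClosed_columnModule (fun x z => ?_) ha
  refine map_mem_of_dense h.denseRange (f := fun x => W ∘L ketLeft H k ∘L leftSlice W x z)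
    (continuous_const.clm_comp (continuous_const.clm_comp (continuous_leftSlice_fst W z)))
    isClosed_columnModule ?_ x
  rintro _ ⟨v, rfl⟩
  refine (map_slice_mem_iff hW.unitary_mem hW.pentagon (.id ℂ (H →L[ℂ] H ⊗ₕ H))
    isClosed_columnModule (Q v)).2 (fun k z => ?_) k z
  refine map_mem_of_dense h.isSelfAdjoint.dense_domain (f := fun z => tmap ((ketRight H
    (Q v)).adjoint ∘L W.adjoint ∘L ketLeft H k) (.id ℂ H) ∘L W ∘L ketLeft H z)
    (continuous_const.clm_comp (continuous_const.clm_comp continuous_ketLeft))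
    isClosed_columnModule (fun z hz => ?_) z
  have h1 := h.tmap_slice_eq k v ⟨z, hz⟩
  dsimp only at h1 ⊢
  rw [h1]
  refine map_mem_of_tmul (conjSlice W' _) isClosed_columnModule (fun e p => ?_) _
  rw [conjSlice_tmul]
  exact ketLeft_comp_mem_columnModule e (h.leftSlice_mem _ p)

/-- The argument for W is run backwards: surjectivity of W̃ shows that the operators (T ⊗ 1) W (|z⟩
⊗ 1) exhaust the column module up to closure, and the sliced pentagon turns W* of them into W* W
(|k⟩ ⊗ slice). -/
lemma IsManaged.adjoint_comp_mem_columnModule (h : IsManaged W Q W')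
    (hW : IsMultiplicativeUnitary W) {T : H →L[ℂ] H ⊗ₕ H}
    (hT : T ∈ columnModule H (quantumAlgebra W)) :
    W.adjoint ∘L T ∈ columnModule H (quantumAlgebra W) := by
  have hW1 : W.adjoint * W = 1 := (Unitary.mem_iff.1 hW.unitary_mem).1
  refine map_mem_of_columnModule (compL ℂ H _ _ W.adjoint) isClosed_columnModule
    (fun e a ha => ?_) hT
  refine map_mem_of_leftSlice (compL ℂ H _ _ W.adjoint ∘L compL ℂ H _ _ (ketLeft H e))
    isClosed_columnModule (fun x z => ?_) ha
  refine map_mem_of_dense h.denseRange (f := fun x => W.adjoint ∘L ketLeft H e ∘L leftSlice W x z)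
    (continuous_const.clm_comp (continuous_const.clm_comp (continuous_leftSlice_fst W z)))
    isClosed_columnModule ?_ x
  rintro _ ⟨p, rfl⟩
  refine map_mem_of_dense h.isSelfAdjoint.dense_domain
    (f := fun z => W.adjoint ∘L ketLeft H e ∘L leftSlice W (Q p) z)
    (continuous_const.clm_comp (continuous_const.clm_comp (continuous_leftSlice_snd W _)))
    isClosed_columnModule (fun z hz => ?_) z
  have h1 := h.leftSlice_eq p ⟨z, hz⟩
  dsimp only at h1 ⊢
  rw [← h1, ← conjSlice_tmul]
  -- The vector e ⊗ p̄ is written as ΣJW̃ξ with J = `conjFlip`, so that ξ can be approximated by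
  -- sums of k̄ ⊗ v with v ∈ dom Q, where `tmap_slice_eq` applies.
  obtain ⟨ξ, hξ⟩ := h.surjective (conjFlip ((flip (ConjSpace H) H).symm (tmul e (toConj (p : H)))))
  have hs : tmul e (toConj (p : H)) = flip (ConjSpace H) H (conjFlip (W' ξ)) := by
    rw [hξ, conjFlip_conjFlip, LinearIsometryEquiv.apply_symm_apply]
  rw [hs]
  clear hs hξ
  have hc : Continuous fun ξ => W.adjoint ∘L conjSlice W' (toConj (Q ⟨z, hz⟩))
      (flip (ConjSpace H) H (conjFlip (W' ξ))) :=
    continuous_const.clm_comp ((conjSlice W' _).continuous.comp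
      ((flip (ConjSpace H) H).continuous.comp (continuous_conjFlip.comp W'.continuous)))
  induction ξ using htensor_induction with
  | hp => exact isClosed_columnModule.preimage hc
  | h0 => simp [conjFlip_zero]
  | ha ξ η hξ hη =>
    simp only [map_add, conjFlip_add, comp_add]
    exact Submodule.add_mem _ hξ hη
  | ht k v =>
    refine map_mem_of_dense h.isSelfAdjoint.dense_domain (f := fun v => W.adjoint ∘L
      conjSlice W' (toConj (Q ⟨z, hz⟩)) (flip (ConjSpace H) H (conjFlip (W' (tmul k v)))))
      (hc.comp (ketLeft H k).continuous) isClosed_columnModule (fun v hv => ?_) v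
    have h2 := h.tmap_slice_eq (ofConj k) ⟨v, hv⟩ ⟨z, hz⟩
    rw [toConj_ofConj] at h2
    dsimp only at h2 ⊢
    rw [← h2]
    refine (map_slice_mem_iff hW.unitary_mem hW.pentagon (compL ℂ H _ _ W.adjoint)
      isClosed_columnModule (Q ⟨v, hv⟩)).1 (fun k z => ?_) (ofConj k) z
    rw [compL_apply, ← comp_assoc, ← mul_def, hW1]
    exact ketLeft_comp_mem_columnModule k (HilbertQG.leftSlice_mem W _ _)

end Managed

end HilbertQG

end

noncomputable section

namespace HilbertQG

open ContinuousLinearMap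

/-! ### The slices form a `C*`-algebra -/

/-- A multiplicative unitary `W` whose algebra `A` of slices satisfies `W (H ⊗ A) = H ⊗ A`, where
`H ⊗ A` is the column module. -/
structure IsColumnStable {H : Type*} [NormedAddCommGroup H] [InnerProductSpace ℂ H]
    [CompleteSpace H] (W : H ⊗ₕ H →L[ℂ] H ⊗ₕ H) : Prop extends IsMultiplicativeUnitary W where
  comp_mem : ∀ T ∈ columnModule H (quantumAlgebra W), W ∘L T ∈ columnModule H (quantumAlgebra W)
  adjoint_comp_mem : ∀ T ∈ columnModule H (quantumAlgebra W),
    W.adjoint ∘L T ∈ columnModule H (quantumAlgebra W)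

section Algebra

variable {H K F : Type*} [NormedAddCommGroup H] [InnerProductSpace ℂ H] [CompleteSpace H]
  [NormedAddCommGroup K] [InnerProductSpace ℂ K] [CompleteSpace K]
  [NormedAddCommGroup F] [NormedSpace ℂ F] {W : H ⊗ₕ H →L[ℂ] H ⊗ₕ H}

lemma IsManaged.isColumnStable {Q : H →ₗ.[ℂ] H} {W' : ConjSpace H ⊗ₕ H →L[ℂ] ConjSpace H ⊗ₕ H}
    (h : IsManaged W Q W') (hW : IsMultiplicativeUnitary W) : IsColumnStable W where
  toIsMultiplicativeUnitary := hW
  comp_mem := fun _ hT => h.comp_mem_columnModule hW hT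
  adjoint_comp_mem := fun _ hT => h.adjoint_comp_mem_columnModule hW hT

/-- The adjoint as a bounded semilinear operator. -/
def adjointL (E : Type*) [NormedAddCommGroup E] [InnerProductSpace ℂ E] [CompleteSpace E] :
    (E →L[ℂ] E) →SL[starRingEnd ℂ] (E →L[ℂ] E) :=
  (ContinuousLinearMap.adjoint (𝕜 := ℂ) (E := E) (F := E)).toContinuousLinearEquiv

lemma ketLeft_adjoint_comp_mem {A : Submodule ℂ (H →L[ℂ] H)} (hA : IsClosed (A : Set (H →L[ℂ] H)))
    (x : K) {T : H →L[ℂ] K ⊗ₕ H} (hT : T ∈ columnModule K A) :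
    (ketLeft H x).adjoint ∘L T ∈ A := by
  refine map_mem_of_columnModule (compL ℂ H _ _ (ketLeft H x).adjoint) hA (fun k a ha => ?_) hT
  rw [compL_apply, ← comp_assoc, ketLeft_adjoint_comp_ketLeft, smul_comp,
    ContinuousLinearMap.id_comp]
  exact A.smul_mem _ ha

namespace IsColumnStable

lemma adjoint_mul_self (h : IsColumnStable W) : W.adjoint * W = 1 :=
  (Unitary.mem_iff.1 h.unitary_mem).1

lemma mul_adjoint_self (h : IsColumnStable W) : W * W.adjoint = 1 :=
  (Unitary.mem_iff.1 h.unitary_mem).2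

/-- For a slice a, the product a* b is a bra applied to W*(|x⟩ ⊗ b), which stays in the column
module. -/
lemma adjoint_mul_mem (h : IsColumnStable W) {a b : H →L[ℂ] H} (ha : a ∈ quantumAlgebra W)
    (hb : b ∈ quantumAlgebra W) : a.adjoint * b ∈ quantumAlgebra W := by
  let f : (H →L[ℂ] H) →SL[starRingEnd ℂ] (H →L[ℂ] H) :=
    ((compL ℂ H H H).flip b).comp (adjointL H)
  have hf : ∀ a, f a = a.adjoint ∘L b := fun a => rfl
  rw [mul_def, ← hf]
  refine map_mem_of_leftSlice f (isClosed_quantumAlgebra W) (fun x z => ?_) ha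
  rw [hf, leftSlice_adjoint, leftSlice, comp_assoc, comp_assoc]
  exact ketLeft_adjoint_comp_mem (isClosed_quantumAlgebra W) z
    (h.adjoint_comp_mem _ (ketLeft_comp_mem_columnModule x hb))

/-- To map a product of elements of `A` into a closed subspace is to map `A` there. -/
lemma map_mem_of_mul (h : IsColumnStable W) {σ : ℂ →+* ℂ} (f : (H →L[ℂ] H) →SL[σ] F)
    {N : Submodule ℂ F} (hN : IsClosed (N : Set F))
    (hf : ∀ x z, ∀ b ∈ quantumAlgebra W, f (leftSlice W x z * b) ∈ N) {b : H →L[ℂ] H}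
    (hb : b ∈ quantumAlgebra W) : f b ∈ N := by
  rcases subsingleton_or_nontrivial H with _ | _
  · rw [Subsingleton.elim b 0, map_zero]; exact N.zero_mem
  obtain ⟨x, hx⟩ := exists_norm_eq H zero_le_one
  have hb' : b ∈ (Submodule.span ℂ (Set.range fun p : (H × H) × quantumAlgebra W =>
      leftSlice W p.1.1 p.1.2 * (p.2 : H →L[ℂ] H))).topologicalClosure := by
    -- Inserting W W* = 1 and approximating W*(|x⟩ ⊗ b) by sums of |k⟩ ⊗ c yields sums of slices
    -- times c.
    have h1 : b = (ketLeft H x).adjoint ∘L W ∘L (W.adjoint ∘L (ketLeft H x ∘L b)) := by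
      rw [← comp_assoc W, ← mul_def W, h.mul_adjoint_self, one_def, ContinuousLinearMap.id_comp,
        ← comp_assoc, ketLeft_adjoint_comp_ketLeft, inner_self_eq_norm_sq_to_K, hx]
      simp
    rw [h1]
    refine map_mem_of_columnModule (compL ℂ H _ _ (ketLeft H x).adjoint ∘L compL ℂ H _ _ W)
      (Submodule.isClosed_topologicalClosure _) (fun k a ha => ?_)
      (h.adjoint_comp_mem _ (ketLeft_comp_mem_columnModule x hb))
    exact subset_closedSpan ⟨((x, k), ⟨a, ha⟩), rfl⟩
  refine map_mem_of_closedSpan f hN ?_ hb'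
  rintro _ ⟨p, rfl⟩
  exact hf _ _ _ p.2.2

/-- Inserting W* W = 1 shows that a lies in the closed span of A*A, which is self-adjoint and
contained in A. -/
lemma adjoint_mem (h : IsColumnStable W) {a : H →L[ℂ] H} (ha : a ∈ quantumAlgebra W) :
    a.adjoint ∈ quantumAlgebra W := by
  rcases subsingleton_or_nontrivial H with _ | _
  · rw [Subsingleton.elim a.adjoint 0]; exact Submodule.zero_mem _
  obtain ⟨x, hx⟩ := exists_norm_eq H zero_le_one
  have ha' : a ∈ (Submodule.span ℂ (Set.range fun p : quantumAlgebra W × quantumAlgebra W =>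
      (p.1 : H →L[ℂ] H).adjoint * (p.2 : H →L[ℂ] H))).topologicalClosure := by
    have h1 : a = (ketLeft H x).adjoint ∘L W.adjoint ∘L (W ∘L (ketLeft H x ∘L a)) := by
      rw [← comp_assoc W.adjoint, ← mul_def W.adjoint, h.adjoint_mul_self, one_def,
        ContinuousLinearMap.id_comp, ← comp_assoc, ketLeft_adjoint_comp_ketLeft,
        inner_self_eq_norm_sq_to_K, hx]
      simp
    rw [h1]
    refine map_mem_of_columnModule (compL ℂ H _ _ (ketLeft H x).adjoint ∘L compL ℂ H _ _ W.adjoint)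
      (Submodule.isClosed_topologicalClosure _) (fun k b hb => ?_)
      (h.comp_mem _ (ketLeft_comp_mem_columnModule x ha))
    refine subset_closedSpan ⟨(⟨_, leftSlice_mem W k x⟩, ⟨b, hb⟩), ?_⟩
    dsimp only
    rw [leftSlice_adjoint]
    rfl
  refine map_mem_of_closedSpan (adjointL H) (isClosed_quantumAlgebra W) ?_ ha'
  rintro _ ⟨⟨⟨b, hb⟩, ⟨c, hc⟩⟩, rfl⟩
  change (b.adjoint * c).adjoint ∈ _
  rw [mul_def, adjoint_comp, adjoint_adjoint]
  exact h.adjoint_mul_mem hc hb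

/-! ### Unitaries adapted to a multiplicative unitary -/

variable {V : K ⊗ₕ H →L[ℂ] K ⊗ₕ H}

/-- Products are dense in A, so a spare factor b is available. The sliced equation leads to (T ⊗ 1)
W (|z⟩ ⊗ b), where W(|z⟩ ⊗ b) ∈ H ⊗ A and T only moves the first leg to K. -/
lemma comp_mem_of_adapted (h : IsColumnStable W) (hV : V ∈ unitary (K ⊗ₕ H →L[ℂ] K ⊗ₕ H))
    (hVW : leg23 K W * leg12 H V = leg12 H V * leg13 H V * leg23 K W)
    {T : H →L[ℂ] K ⊗ₕ H} (hT : T ∈ columnModule K (quantumAlgebra W)) :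
    V ∘L T ∈ columnModule K (quantumAlgebra W) := by
  refine map_mem_of_columnModule (compL ℂ H _ _ V) isClosed_columnModule (fun k a ha => ?_) hT
  refine h.map_mem_of_mul (compL ℂ H _ _ V ∘L compL ℂ H _ _ (ketLeft H k))
    isClosed_columnModule (fun x z b hb => ?_) ha
  refine (map_slice_mem_iff hV hVW ((compL ℂ H H (K ⊗ₕ H)).flip b)
    isClosed_columnModule x).2 (fun k z => ?_) k z
  refine map_mem_of_columnModule (compL ℂ H _ _ (tmap ((ketRight K x).adjoint ∘L V.adjoint ∘L
    ketLeft H k) (.id ℂ H))) isClosed_columnModule (fun y c hc => ?_)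
    (h.comp_mem _ (ketLeft_comp_mem_columnModule z hb))
  rw [compL_apply, ← comp_assoc, tmap_comp_ketLeft, ContinuousLinearMap.comp_id]
  exact ketLeft_comp_mem_columnModule _ hc

/-- The sliced equation handles V*(T ⊗ 1) W (|z⟩ ⊗ c), where V* V cancels. Inserting W W* = 1
removes the W, and the vectors T z span K densely. -/
lemma adjoint_comp_mem_of_adapted (h : IsColumnStable W)
    (hV : V ∈ unitary (K ⊗ₕ H →L[ℂ] K ⊗ₕ H))
    (hVW : leg23 K W * leg12 H V = leg12 H V * leg13 H V * leg23 K W)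
    {T : H →L[ℂ] K ⊗ₕ H} (hT : T ∈ columnModule K (quantumAlgebra W)) :
    V.adjoint ∘L T ∈ columnModule K (quantumAlgebra W) := by
  rcases subsingleton_or_nontrivial H with _ | _
  · rw [Subsingleton.elim (V.adjoint ∘L T) 0]; exact Submodule.zero_mem _
  obtain ⟨x, hx⟩ := exists_norm_eq H zero_le_one
  have hV1 : V.adjoint * V = 1 := (Unitary.mem_iff.1 hV).1
  refine map_mem_of_columnModule (compL ℂ H _ _ V.adjoint) isClosed_columnModule
    (fun k b hb => ?_) hT
  have h1 : ∀ k, ∀ c ∈ quantumAlgebra W, ∀ z, V.adjoint ∘L (tmap ((ketRight K x).adjoint ∘L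
      V.adjoint ∘L ketLeft H k) (.id ℂ H) ∘L W ∘L ketLeft H z) ∘L c ∈
        columnModule K (quantumAlgebra W) := by
    intro k c hc z
    refine (map_slice_mem_iff hV hVW (compL ℂ H _ _ V.adjoint ∘L
      (compL ℂ H H (K ⊗ₕ H)).flip c) isClosed_columnModule x).1 (fun k z => ?_) k z
    change V.adjoint ∘L ((V ∘L ketLeft H k ∘L leftSlice W x z) ∘L c) ∈ _
    rw [comp_assoc, ← comp_assoc, ← mul_def, hV1]
    refine ketLeft_comp_mem_columnModule k (a := leftSlice W x z ∘L c) ?_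
    have h2 := h.adjoint_mul_mem (h.adjoint_mem (leftSlice_mem W x z)) hc
    rwa [adjoint_adjoint] at h2
  have h2 : ∀ k z, V.adjoint ∘L ketLeft H (((ketRight K x).adjoint ∘L V.adjoint) (tmul k z)) ∘L b ∈
      columnModule K (quantumAlgebra W) := by
    intro k z
    have h3 := map_mem_of_columnModule (compL ℂ H _ _ V.adjoint ∘L compL ℂ H _ _
      (tmap ((ketRight K x).adjoint ∘L V.adjoint ∘L ketLeft H k) (.id ℂ H)) ∘L compL ℂ H _ _ W)
      isClosed_columnModule (fun z c hc => h1 k c hc z)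
      (h.adjoint_comp_mem _ (ketLeft_comp_mem_columnModule z hb))
    simp only [comp_apply, compL_apply] at h3
    rwa [← comp_assoc W, ← mul_def W, h.mul_adjoint_self, one_def, ContinuousLinearMap.id_comp,
      ← comp_assoc (tmap _ _), tmap_comp_ketLeft, ContinuousLinearMap.comp_id] at h3
  -- The evaluation at V(k ⊗ x) recovers k itself, since (1 ⊗ ⟨x|) V* V (k ⊗ x) = k for a unit
  -- vector x.
  have h3 := map_mem_of_tmul (compL ℂ H _ _ V.adjoint ∘L (compL ℂ H H (K ⊗ₕ H)).flip b ∘L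
    ketLeftL K H ∘L (ketRight K x).adjoint ∘L V.adjoint) isClosed_columnModule h2 (V (tmul k x))
  have h4 : V.adjoint (V (tmul k x)) = tmul k x := DFunLike.congr_fun hV1 _
  have h5 : (ketRight K x).adjoint (tmul k x) = k := by
    rw [ketRight_adjoint_tmul, inner_self_eq_norm_sq_to_K, hx]; simp
  simp only [comp_apply, h4, h5] at h3
  exact h3

end IsColumnStable

end Algebra

/-! ### Bicharacters -/

/-! ### The dual multiplicative unitary and its algebra -/

section Dual

variable {H : Type*} [NormedAddCommGroup H] [InnerProductSpace ℂ H] [CompleteSpace H]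
  {W : H ⊗ₕ H →L[ℂ] H ⊗ₕ H}

variable (H) in
/-- The flip as a bounded operator. -/
abbrev flipL : H ⊗ₕ H →L[ℂ] H ⊗ₕ H := (flip H H : H ⊗ₕ H →L[ℂ] H ⊗ₕ H)

lemma flipL_mul_self : flipL H * flipL H = 1 := clm_ext fun h k => by simp

lemma flipL_adjoint : (flipL H).adjoint = flipL H :=
  adjoint_eq_of_inner_tmul _ _ fun x y x' y' => by simp [mul_comm]

lemma dualUnitary_eq : dualUnitary W = flipL H * W.adjoint * flipL H := rfl

lemma dualUnitary_adjoint : (dualUnitary W).adjoint = flipL H * W * flipL H := by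
  simp only [dualUnitary, adjoint_comp, flipL_adjoint, adjoint_adjoint]
  rfl

variable (H) in
/-- The unitary `x ⊗ y ⊗ z ↦ z ⊗ y ⊗ x`. -/
def flip13 : (H ⊗ₕ H) ⊗ₕ H →L[ℂ] (H ⊗ₕ H) ⊗ₕ H :=
  leg12 H (flipL H) * leg23 H (flipL H) * leg12 H (flipL H)

@[simp] lemma flip13_tmul (x y z : H) :
    flip13 H (tmul (tmul x y) z) = tmul (tmul z y) x := by
  simp [flip13]

lemma flip13_mul_self : flip13 H * flip13 H = 1 := clm_ext₃ fun x y z => by simp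

lemma flip13_tmul_right (ξ : H ⊗ₕ H) (z : H) :
    flip13 H (tmul ξ z) = tmap (ketLeft H z) (.id ℂ H) (flipL H ξ) :=
  DFunLike.congr_fun (f := flip13 H ∘L ketRight (H ⊗ₕ H) z)
    (g := tmap (ketLeft H z) (.id ℂ H) ∘L flipL H) (clm_ext fun k l => by simp) ξ

lemma flip13_tmap_ketLeft (ξ : H ⊗ₕ H) (x : H) :
    flip13 H (tmap (ketLeft H x) (.id ℂ H) ξ) = tmul (flipL H ξ) x :=
  DFunLike.congr_fun (f := flip13 H ∘L tmap (ketLeft H x) (.id ℂ H))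
    (g := ketRight (H ⊗ₕ H) x ∘L flipL H) (clm_ext fun k l => by simp) ξ

lemma flip13_tmap_ketRight (ξ : H ⊗ₕ H) (y : H) :
    flip13 H (tmap (ketRight H y) (.id ℂ H) ξ) = tmap (ketRight H y) (.id ℂ H) (flipL H ξ) :=
  DFunLike.congr_fun (f := flip13 H ∘L tmap (ketRight H y) (.id ℂ H))
    (g := tmap (ketRight H y) (.id ℂ H) ∘L flipL H) (clm_ext fun k l => by simp) ξ

/-- Reversing the order of the three legs turns the pentagon equation of ΣW*Σ into the adjoint of
that of W. -/
lemma leg12_flip_conj (T : H ⊗ₕ H →L[ℂ] H ⊗ₕ H) :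
    leg12 H (flipL H * T * flipL H) = flip13 H * leg23 H T * flip13 H :=
  clm_ext₃ fun x y z => by simp [flip13_tmap_ketLeft]

lemma leg23_flip_conj (T : H ⊗ₕ H →L[ℂ] H ⊗ₕ H) :
    leg23 H (flipL H * T * flipL H) = flip13 H * leg12 H T * flip13 H :=
  clm_ext₃ fun x y z => by simp [flip13_tmul_right]

lemma leg13_flip_conj (T : H ⊗ₕ H →L[ℂ] H ⊗ₕ H) :
    leg13 H (flipL H * T * flipL H) = flip13 H * leg13 H T * flip13 H :=
  clm_ext₃ fun x y z => by simp [flip13_tmap_ketRight]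

lemma mul_conj_mul_conj {R : Type*} [Monoid R] {f : R} (hf : f * f = 1) (a b : R) :
    f * a * f * (f * b * f) = f * (a * b) * f := by
  simp only [mul_assoc]
  rw [← mul_assoc f f, hf, one_mul]

lemma IsMultiplicativeUnitary.adjoint_pentagon (hW : IsMultiplicativeUnitary W) :
    leg12 H W.adjoint * leg23 H W.adjoint =
      leg23 H W.adjoint * leg13 H W.adjoint * leg12 H W.adjoint := by
  obtain ⟨h1, h2⟩ := Unitary.mem_iff.1 hW.unitary_mem
  rw [star_eq_adjoint] at h1 h2
  have l : leg12 H W.adjoint * leg12 H W = 1 := by rw [← leg12_mul, h1, leg12_one]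
  have l' : leg13 H W.adjoint * leg13 H W = 1 := by rw [← leg13_mul, h1, leg13_one]
  have l'' : leg23 H W.adjoint * leg23 H W = 1 := by rw [← leg23_mul, h1, leg23_one]
  have r : leg12 H W * leg12 H W.adjoint = 1 := by rw [← leg12_mul, h2, leg12_one]
  have r'' : leg23 H W * leg23 H W.adjoint = 1 := by rw [← leg23_mul, h2, leg23_one]
  refine (left_inv_eq_right_inv (a := leg23 H W * leg12 H W) ?_ ?_).symm
  · rw [hW.pentagon]
    calc leg23 H W.adjoint * leg13 H W.adjoint * leg12 H W.adjoint *
          (leg12 H W * leg13 H W * leg23 H W) =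
        leg23 H W.adjoint * (leg13 H W.adjoint * (leg12 H W.adjoint * leg12 H W) * leg13 H W) *
          leg23 H W := by simp only [mul_assoc]
      _ = 1 := by rw [l, mul_one, l', mul_one, l'']
  · rw [mul_assoc, ← mul_assoc (leg12 H W), r, one_mul, r'']

lemma IsMultiplicativeUnitary.dual (hW : IsMultiplicativeUnitary W) :
    IsMultiplicativeUnitary (dualUnitary W) where
  unitary_mem := by
    obtain ⟨h1, h2⟩ := Unitary.mem_iff.1 hW.unitary_mem
    rw [star_eq_adjoint] at h1 h2
    rw [Unitary.mem_iff, star_eq_adjoint, dualUnitary_adjoint, dualUnitary_eq,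
      mul_conj_mul_conj flipL_mul_self, mul_conj_mul_conj flipL_mul_self, h1, h2, mul_one,
      flipL_mul_self]
    exact ⟨rfl, rfl⟩
  pentagon := by
    rw [dualUnitary_eq, leg12_flip_conj, leg23_flip_conj, leg13_flip_conj]
    simp only [mul_conj_mul_conj flip13_mul_self]
    rw [hW.adjoint_pentagon]

/-- The algebra of the dual multiplicative unitary is the dual algebra, up to adjoints. -/
lemma leftSlice_dualUnitary (x z : H) : leftSlice (dualUnitary W) x z =
    ((ketRight H z).adjoint ∘L W ∘L ketRight H x).adjoint := by
  have h : ∀ x : H, flipL H ∘L ketLeft H x = ketRight H x := fun x => by ext; simp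
  rw [leftSlice, dualUnitary]
  rw [adjoint_comp, adjoint_comp, adjoint_adjoint, ← h z, ← h x, adjoint_comp, flipL_adjoint]
  rfl

/-- Right slices of W are adjoints of left slices of ΣW*Σ, and the algebra of the latter is closed
under adjoints. -/
lemma dualQuantumAlgebra_eq (h : IsColumnStable (dualUnitary W)) :
    dualQuantumAlgebra W = quantumAlgebra (dualUnitary W) := by
  have hsl : ∀ x z : H, (ketRight H x).adjoint ∘L W ∘L ketRight H z =
      (leftSlice (dualUnitary W) z x).adjoint := fun x z => by
    rw [leftSlice_dualUnitary, adjoint_adjoint]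
  apply le_antisymm
  · intro a ha
    refine map_mem_of_closedSpan (.id ℂ (H →L[ℂ] H)) (isClosed_quantumAlgebra _) ?_ ha
    rintro _ ⟨⟨x, z⟩, rfl⟩
    change (ketRight H x).adjoint ∘L W ∘L ketRight H z ∈ _
    rw [hsl]
    exact h.adjoint_mem (leftSlice_mem _ _ _)
  · intro a ha
    have h1 : adjointL H a.adjoint ∈ dualQuantumAlgebra W := by
      refine map_mem_of_leftSlice (adjointL H) (Submodule.isClosed_topologicalClosure _) (fun x z => ?_)
        (h.adjoint_mem ha)
      change (leftSlice (dualUnitary W) x z).adjoint ∈ _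
      rw [← hsl]
      exact subset_closedSpan ⟨(z, x), rfl⟩
    have h2 : adjointL H a.adjoint = a := adjoint_adjoint a
    rwa [h2] at h1

end Dual

/-! ### From the pentagon-like equations to bicharacters -/

section Bicharacter

variable {H K : Type*} [NormedAddCommGroup H] [InnerProductSpace ℂ H] [CompleteSpace H]
  [NormedAddCommGroup K] [InnerProductSpace ℂ K] [CompleteSpace K]
  {X : H ⊗ₕ H →L[ℂ] H ⊗ₕ H} {Y : K ⊗ₕ K →L[ℂ] K ⊗ₕ K} {V : H ⊗ₕ K →L[ℂ] H ⊗ₕ K}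

/-- The closed linear span of the operators `b ⊗ |h⟩ ⊗ a` for `b ∈ B`, `h ∈ H`, `a ∈ A`. -/
def middleModule (B : Submodule ℂ (H →L[ℂ] H)) (A : Submodule ℂ (K →L[ℂ] K)) :
    Submodule ℂ (H ⊗ₕ K →L[ℂ] (H ⊗ₕ H) ⊗ₕ K) :=
  (Submodule.span ℂ (Set.range fun p : B × H × A =>
    tmap (ketRight H p.2.1 ∘L (p.1 : H →L[ℂ] H)) (p.2.2 : K →L[ℂ] K))).topologicalClosure

variable {A : Submodule ℂ (K →L[ℂ] K)} {B : Submodule ℂ (H →L[ℂ] H)}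

lemma isClosed_middleModule :
    IsClosed (middleModule B A : Set (H ⊗ₕ K →L[ℂ] (H ⊗ₕ H) ⊗ₕ K)) :=
  Submodule.isClosed_topologicalClosure _

lemma tmap_mem_middleModule {b : H →L[ℂ] H} (hb : b ∈ B) (h : H) {a : K →L[ℂ] K} (ha : a ∈ A) :
    tmap (ketRight H h ∘L b) a ∈ middleModule B A :=
  subset_closedSpan ⟨(⟨b, hb⟩, h, ⟨a, ha⟩), rfl⟩

/-- The flip moves the ket from the second leg to the first, where stability of the column module H
⊗ B applies; the third leg is idle. -/
lemma leg12_comp_mem_middleModule {T : H ⊗ₕ H →L[ℂ] H ⊗ₕ H}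
    (hT : ∀ R ∈ columnModule H B, (flipL H * T * flipL H) ∘L R ∈ columnModule H B)
    {S : H ⊗ₕ K →L[ℂ] (H ⊗ₕ H) ⊗ₕ K} (hS : S ∈ middleModule B A) :
    leg12 K T ∘L S ∈ middleModule B A := by
  have hf : ∀ h : H, flipL H ∘L ketLeft H h = ketRight H h := fun h => by ext; simp
  refine map_mem_of_closedSpan (compL ℂ (H ⊗ₕ K) _ _ (leg12 K T)) isClosed_middleModule ?_ hS
  rintro _ ⟨⟨⟨b, hb⟩, h, ⟨a, ha⟩⟩, rfl⟩
  have h1 := map_mem_of_columnModule (tmapLeftL H (H ⊗ₕ H) a ∘L compL ℂ H _ _ (flipL H))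
    (isClosed_middleModule (A := A) (B := B)) (fun k c hc => ?_) (hT _ (ketLeft_comp_mem_columnModule h hb))
  · change tmap ((flipL H * (flipL H * T * flipL H)) ∘L (ketLeft H h ∘L b)) a ∈ _ at h1
    rw [← mul_assoc, ← mul_assoc, flipL_mul_self, one_mul, ← comp_assoc, mul_def, comp_assoc T,
      hf] at h1
    rwa [compL_apply, leg12, tmap_comp, ContinuousLinearMap.id_comp, ← comp_assoc]
  · change tmap (flipL H ∘L ketLeft H k ∘L c) a ∈ _
    rw [← comp_assoc, hf]
    exact tmap_mem_middleModule hc k ha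

lemma leg23_comp_mem_middleModule {T : H ⊗ₕ K →L[ℂ] H ⊗ₕ K}
    (hT : ∀ R ∈ columnModule H A, T ∘L R ∈ columnModule H A)
    {S : H ⊗ₕ K →L[ℂ] (H ⊗ₕ H) ⊗ₕ K} (hS : S ∈ middleModule B A) :
    leg23 H T ∘L S ∈ middleModule B A := by
  refine map_mem_of_closedSpan (compL ℂ (H ⊗ₕ K) _ _ (leg23 H T)) isClosed_middleModule ?_ hS
  rintro _ ⟨⟨⟨b, hb⟩, h, ⟨a, ha⟩⟩, rfl⟩
  let e : H ⊗ₕ (H ⊗ₕ K) →L[ℂ] (H ⊗ₕ H) ⊗ₕ K := (assoc H H K).symm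
  have h1 := map_mem_of_columnModule (compL ℂ (H ⊗ₕ K) _ _ e ∘L tmapRightL K (H ⊗ₕ K) b)
    (isClosed_middleModule (A := A) (B := B)) (fun k c hc => ?_)
    (hT _ (ketLeft_comp_mem_columnModule h ha))
  · convert h1 using 1
    refine clm_ext fun x y => ?_
    simp [e, assoc_symm_tmul_left]
  · convert tmap_mem_middleModule hb k hc using 1
    refine clm_ext fun x y => ?_
    simp [e]

/-- For a unit vector x, V(b ⊗ a) is recovered from V₁₃(b ⊗ |x⟩ ⊗ a) by the bra ⟨x| in the middle
leg. -/
lemma comp_mem_spatialTensor (hB : ∀ R ∈ middleModule B A, leg13 H V ∘L R ∈ middleModule B A)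
    {S : H ⊗ₕ K →L[ℂ] H ⊗ₕ K} (hS : S ∈ spatialTensor B A) : V ∘L S ∈ spatialTensor B A := by
  have hcl : IsClosed (spatialTensor B A : Set (H ⊗ₕ K →L[ℂ] H ⊗ₕ K)) :=
    Submodule.isClosed_topologicalClosure _
  rcases subsingleton_or_nontrivial H with _ | _
  · have : V ∘L S = 0 := clm_ext fun x y => by
      rw [Subsingleton.elim x 0, ← ketRight_apply, map_zero, map_zero, map_zero]
    rw [this]; exact Submodule.zero_mem _
  obtain ⟨x, hx⟩ := exists_norm_eq H zero_le_one
  refine map_mem_of_closedSpan (compL ℂ (H ⊗ₕ K) _ _ V) hcl ?_ hS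
  rintro _ ⟨⟨⟨b, hb⟩, ⟨a, ha⟩⟩, rfl⟩
  have hsl : ∀ (h : H) (b : H →L[ℂ] H) (a : K →L[ℂ] K),
      tmap (ketRight H x).adjoint (.id ℂ K) ∘L tmap (ketRight H h ∘L b) a =
        ⟪x, h⟫_ℂ • tmap b a := fun h b a => by
    refine clm_ext fun p q => ?_
    simp [smul_tmul]
  have h1 := map_mem_of_closedSpan (compL ℂ (H ⊗ₕ K) _ _ (tmap (ketRight H x).adjoint (.id ℂ K)))
    hcl ?_ (hB _ (tmap_mem_middleModule hb x ha))
  · rw [compL_apply, ← comp_assoc, slice_leg13, comp_assoc, hsl, inner_self_eq_norm_sq_to_K,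
      hx] at h1
    simpa using h1
  · rintro _ ⟨⟨⟨c, hc⟩, h, ⟨d, hd⟩⟩, rfl⟩
    rw [compL_apply, hsl]
    exact Submodule.smul_mem _ _ (subset_closedSpan ⟨(⟨c, hc⟩, ⟨d, hd⟩), rfl⟩)

lemma adjoint_mem_spatialTensor (hA : ∀ a ∈ A, a.adjoint ∈ A) (hB : ∀ b ∈ B, b.adjoint ∈ B)
    {S : H ⊗ₕ K →L[ℂ] H ⊗ₕ K} (hS : S ∈ spatialTensor B A) : S.adjoint ∈ spatialTensor B A := by
  refine map_mem_of_closedSpan (adjointL (H ⊗ₕ K))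
    (Submodule.isClosed_topologicalClosure _) ?_ hS
  rintro _ ⟨⟨⟨b, hb⟩, ⟨a, ha⟩⟩, rfl⟩
  change (tmap b a).adjoint ∈ _
  rw [tmap_adjoint]
  exact subset_closedSpan ⟨(⟨_, hB b hb⟩, ⟨_, hA a ha⟩), rfl⟩

/-- A unitary that satisfies the two pentagon-like equations with respect to multiplicative
unitaries `X` and `Y` is a bicharacter. -/
lemma isBicharacter_of_pentagon (hXu : IsMultiplicativeUnitary X)
    (hX : IsColumnStable (dualUnitary X)) (hY : IsColumnStable Y)
    (hV : V ∈ unitary (H ⊗ₕ K →L[ℂ] H ⊗ₕ K))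
    (hVX : leg23 H V * leg12 K X = leg12 K X * leg13 H V * leg23 H V)
    (hVY : leg23 H Y * leg12 K V = leg12 K V * leg13 K V * leg23 H Y) :
    IsBicharacter X Y V := by
  obtain ⟨hV1, hV2⟩ := Unitary.mem_iff.1 hV
  obtain ⟨hX1, hX2⟩ := Unitary.mem_iff.1 hXu.unitary_mem
  have hY2 := hY.mul_adjoint_self
  rw [star_eq_adjoint] at hV1 hV2 hX1 hX2
  have hr : leg23 H V * leg23 H V.adjoint = 1 := by rw [← leg23_mul, hV2, leg23_one]
  have hl : leg23 H V.adjoint * leg23 H V = 1 := by rw [← leg23_mul, hV1, leg23_one]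
  have hXl : leg12 K X.adjoint * leg12 K X = 1 := by rw [← leg12_mul, hX1, leg12_one]
  have hXr : leg12 K X * leg12 K X.adjoint = 1 := by rw [← leg12_mul, hX2, leg12_one]
  have h13 : leg13 H V * leg23 H V = leg12 K X.adjoint * leg23 H V * leg12 K X := by
    rw [mul_assoc, hVX, mul_assoc, ← mul_assoc, hXl, one_mul]
  -- The third leg of X₁₂ and the first leg of V₂₃ are idle, so the stability results for X and V
  -- can be applied factor by factor.
  have h13V : leg13 H V = leg12 K X.adjoint * leg23 H V * leg12 K X * leg23 H V.adjoint := by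
    rw [← h13, mul_assoc, hr, mul_one]
  have h13V' : leg13 H V.adjoint =
      leg23 H V * leg12 K X.adjoint * leg23 H V.adjoint * leg12 K X := by
    refine left_inv_eq_right_inv (a := leg13 H V) (by rw [← leg13_mul, hV1, leg13_one]) ?_
    rw [h13V]
    calc _ = leg12 K X.adjoint * (leg23 H V * (leg12 K X * (leg23 H V.adjoint * leg23 H V) *
          leg12 K X.adjoint) * leg23 H V.adjoint) * leg12 K X := by simp only [mul_assoc]
      _ = 1 := by rw [hl, mul_one, hXr, mul_one, hr, mul_one, hXl]
  set A := quantumAlgebra Y with hA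
  set B := quantumAlgebra (dualUnitary X) with hB
  have hX12 : ∀ R ∈ middleModule B A, leg12 K X ∘L R ∈ middleModule B A := fun R hR =>
    leg12_comp_mem_middleModule (fun S hS => by
      have := hX.adjoint_comp_mem S hS
      rwa [dualUnitary_adjoint] at this) hR
  have hX12' : ∀ R ∈ middleModule B A, leg12 K X.adjoint ∘L R ∈ middleModule B A := fun R hR =>
    leg12_comp_mem_middleModule (fun S hS => hX.comp_mem S hS) hR
  have hV23 : ∀ R ∈ middleModule B A, leg23 H V ∘L R ∈ middleModule B A := fun R hR =>
    leg23_comp_mem_middleModule (fun S hS => hY.comp_mem_of_adapted hV hVY hS) hR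
  have hV23' : ∀ R ∈ middleModule B A, leg23 H V.adjoint ∘L R ∈ middleModule B A := fun R hR =>
    leg23_comp_mem_middleModule (fun S hS => hY.adjoint_comp_mem_of_adapted hV hVY hS) hR
  have hVS : ∀ S ∈ spatialTensor B A, V ∘L S ∈ spatialTensor B A := fun S hS =>
    comp_mem_spatialTensor (fun R hR => by
      rw [h13V]; exact hX12' _ (hV23 _ (hX12 _ (hV23' _ hR)))) hS
  have hVS' : ∀ S ∈ spatialTensor B A, V.adjoint ∘L S ∈ spatialTensor B A := fun S hS =>
    comp_mem_spatialTensor (fun R hR => by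
      rw [h13V']; exact hV23 _ (hX12' _ (hV23' _ (hX12 _ hR)))) hS
  have hadj : ∀ S ∈ spatialTensor B A, S.adjoint ∈ spatialTensor B A := fun S hS =>
    adjoint_mem_spatialTensor (fun a ha => hY.adjoint_mem ha) (fun b hb => hX.adjoint_mem hb) hS
  refine ⟨hV, ?_, ?_, ?_⟩
  · rw [dualQuantumAlgebra_eq hX]
    refine fun S hS => ⟨hVS S hS, ?_⟩
    -- Right multiplication reduces to left multiplication by S V = (V* S*)*.
    have h1 := hadj _ (hVS' _ (hadj S hS))
    rwa [adjoint_comp, adjoint_adjoint, adjoint_adjoint] at h1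
  -- X₁₂* V₂₃ X₁₂ = V₁₃ V₂₃, and the outer flips interchange legs 1 and 2.
  · rw [dualComulFst, leg12_adjoint, ← h13, ← mul_assoc, leg12_flip_mul_leg13]
    have h1 : leg12 K (flipL H) * leg23 H V = leg13 H V * leg12 K (flipL H) := by
      calc leg12 K (flipL H) * leg23 H V
          = leg12 K (flipL H) * (leg23 H V * leg12 K (flipL H)) * leg12 K (flipL H) := by
            rw [mul_assoc, mul_assoc, leg12_flip_mul_self, mul_one]
        _ = leg13 H V * leg12 K (flipL H) := by
            rw [← leg12_flip_mul_leg13, ← mul_assoc, leg12_flip_mul_self, one_mul]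
    rw [mul_assoc (leg23 H V), h1, mul_assoc, mul_assoc, leg12_flip_mul_self, mul_one]
  · rw [comulSnd, hVY, leg23_adjoint, mul_assoc, ← leg23_mul, hY2, leg23_one, mul_one]

lemma IsManageable.isColumnStable (h : IsManageable Y) (hY : IsMultiplicativeUnitary Y) :
    IsColumnStable Y := by
  obtain ⟨Q, Y', hQ⟩ := h.exists_isManaged
  exact hQ.isColumnStable hY

lemma IsManageable.isColumnStable_dual (h : IsManageable Y) (hY : IsMultiplicativeUnitary Y) :
    IsColumnStable (dualUnitary Y) := by
  obtain ⟨Q, Y', hQ⟩ := h.exists_isManaged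
  exact hQ.dual.isColumnStable hY.dual

/-- A unitary that satisfies the two pentagon-like equations with respect to manageable
multiplicative unitaries is a bicharacter. -/
lemma IsManageable.isBicharacter (hX : IsManageable X) (hXu : IsMultiplicativeUnitary X)
    (hY : IsManageable Y) (hYu : IsMultiplicativeUnitary Y)
    (hV : V ∈ unitary (H ⊗ₕ K →L[ℂ] H ⊗ₕ K))
    (hVX : leg23 H V * leg12 K X = leg12 K X * leg13 H V * leg23 H V)
    (hVY : leg23 H Y * leg12 K V = leg12 K V * leg13 K V * leg23 H Y) :
    IsBicharacter X Y V :=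
  isBicharacter_of_pentagon hXu (hX.isColumnStable_dual hXu) (hY.isColumnStable hYu) hV hVX hVY

end Bicharacter

end HilbertQG

end

theorem mainTheorem5 (C : HilbertTensorCategory.{u, v}) {H H' : Type u}
    [NormedAddCommGroup H] [InnerProductSpace ℂ H] [CompleteSpace H]
    [NormedAddCommGroup H'] [InnerProductSpace ℂ H'] [CompleteSpace H']
    (ρ : C.Obj H) (A : NaturalRightAbsorber C ρ) (ρ' : C.Obj H') (A' : NaturalRightAbsorber C ρ')
    (U : H ⊗ₕ H →L[ℂ] H ⊗ₕ H) (hU : U = A.U ρ)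
    (U' : H' ⊗ₕ H' →L[ℂ] H' ⊗ₕ H') (hU' : U' = A'.U ρ')
    (V : H' ⊗ₕ H →L[ℂ] H' ⊗ₕ H) (hV : V = A.U ρ')
    (W : H ⊗ₕ H' →L[ℂ] H ⊗ₕ H') (hW : W = A'.U ρ) :
    (IsMultiplicativeUnitary U ∧ IsMultiplicativeUnitary U') ∧
    (leg23 H' U * leg12 H V = leg12 H V * leg13 H V * leg23 H' U ∧
      leg23 H U' * leg12 H' W = leg12 H' W * leg13 H' W * leg23 H U' ∧
      leg23 H' V * leg12 H U' = leg12 H U' * leg13 H' V * leg23 H' V ∧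
      leg23 H W * leg12 H' U = leg12 H' U * leg13 H W * leg23 H W ∧
      leg23 H V * leg12 H W = leg12 H W * leg13 H' U * leg23 H V ∧
      leg23 H' W * leg12 H' V = leg12 H' V * leg13 H U' * leg23 H' W) ∧
    (IsManageable U → IsManageable U' → AreInverseMorphisms U' U V W) := by
  subst hU hU' hV hW
  have hm := A.isMultiplicativeUnitary
  have hm' := A'.isMultiplicativeUnitary
  have e1 := A.leg23_mul_leg12 A ρ'
  have e2 := A'.leg23_mul_leg12 A' ρ
  have e3 := A'.leg23_mul_leg12 A ρ'
  have e4 := A.leg23_mul_leg12 A' ρ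
  have e5 := A'.leg23_mul_leg12 A ρ
  have e6 := A.leg23_mul_leg12 A' ρ'
  refine ⟨⟨hm, hm'⟩, ⟨e1, e2, e3, e4, e5, e6⟩, fun h h' => ?_⟩
  have hbV := h'.isBicharacter hm' h hm (A.unitary_mem ρ') e3 e1
  have hbW := h.isBicharacter hm h' hm' (A'.unitary_mem ρ) e4 e2
  -- The pentagon equation serves as both bicharacter equations of the identity morphisms; `e6` and
  -- `e5` are the composition equations.
  exact ⟨⟨hbV, hbW, h'.isBicharacter hm' h' hm' hm'.unitary_mem hm'.pentagon hm'.pentagon, e6⟩,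
    ⟨hbW, hbV, h.isBicharacter hm h hm hm.unitary_mem hm.pentagon hm.pentagon, e5⟩⟩
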